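/- Fix $K\ge 0$ and consider terminals $T_0$ (source), $T_1,\dots,T_K$ (relays) and $T_{K+1}$ (destination), finite alphabets $\mathcal S_0,\dots,\mathcal S_{K+1}$, $\mathcal X_0,\dots,\mathcal X_K$, $\mathcal Y_1,\dots,\mathcal Y_{K+1}$, a joint probability mass function $p(s_0,\dots,s_{K+1})$ and a channel $p(y_1,\dots,y_{K+1}\mid x_0,\dots,x_K)$. The vectors $(S_{0,l},\dots,S_{K+1,l})$, $l\ge 1$, are i.i.d. with law $p(s_0,\dots,s_{K+1})$; terminal $T_i$ observes $S_i^m$, and the channel is memoryless. An $(m,n)$ code consists of a source encoder $X_0^n=f_0(S_0^m)$, relay encoders $X_{i,t}=f_{i,t}(Y_{i,1},\dots,Y_{i,t-1},S_i^m)$ for $1\le i\le K$, $1\le t\le n$, and a decoder $\hat S_0^m=g(Y_{K+1}^n,S_{K+1}^m)\in\mathcal S_0^m$. Its error probability is $P_e^{(m,n)}=\Pr\{\hat S_0^m\ne S_0^m\}$. A rate $r\ge 0$ (source samples per channel use) is achievable if there is a sequence of $(m,n)$ codes with $m/n\ge r$, $m,n\to\infty$ and $P_e^{(m,n)}\to 0$.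 **Theorem.** Let $r\ge 0$. Suppose that there are an integer $1\le N\le K+1$, an injection $\pi:\{0,\dots,N\}\to\{0,\dots,K+1\}$ with $\pi(0)=0$ and $\pi(N)=K+1$, and an input distribution $p(x_0,\dots,x_K)$ under which the inputs $(X_{\pi(0)},\dots,X_{\pi(N-1)})$ of the cooperating terminals are independent of the inputs of the relays outside the image of $\pi$ (no restriction if there are no such relays), such that $$ r<\frac{I\bigl(X_{\pi(0)},\dots,X_{\pi(i-1)};\,Y_{\pi(i)}\,\big|\,X_{\pi(i)},\dots,X_{\pi(N-1)}\bigr)}{H(S_0\mid S_{\pi(i)})}\qquad\text{for all } i=1,\dots,N, $$ where the mutual information is computed under $p(x_0,\dots,x_K)\,p(y_1,\dots,y_{K+1}\mid x_0,\dots,x_K)$ and a quotient with denominator $0$ is read as $+\infty$. Then the source-channel code rate $r$ is achievable. -/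

import Mathlib

/-!
Conventions.  The terminals are indexed by `Fin (K + 2)`: `0` is the source, `1, …, K` are the
relays, `K + 1 = Fin.last (K + 1)` is the destination.

* `S i`, for `i : Fin (K + 2)`, is the alphabet of the signal observed by terminal `i`;
* `X j`, for `j : Fin (K + 1)`, is the input alphabet of terminal `j.castSucc` (that is, `j`);
* `Y v`, for `v : Fin (K + 1)`, is the output alphabet of terminal `v.succ` (that is, `v + 1`).

Probability mass functions on a finite set are the elements of `stdSimplex ℝ _`.
Entropies are in nats; only their quotients matter.
-/

namespace RelayNetwork

section Information

variable {Ω α β γ : Type*}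

open Classical in
/-- The probability `P(f = a)` when the outcome has probability mass function `p`. -/
noncomputable def law [Fintype Ω] (p : Ω → ℝ) (f : Ω → α) (a : α) : ℝ :=
  ∑ ω, if f ω = a then p ω else 0

/-- Conditional entropy `H(f | g) = ∑ p(a, b) log (p(b) / p(a, b))`, with `0 log _ = 0`. -/
noncomputable def condEntropy [Fintype Ω] [Fintype α] [Fintype β]
    (p : Ω → ℝ) (f : Ω → α) (g : Ω → β) : ℝ :=
  ∑ a, ∑ b, law p (fun ω => (f ω, g ω)) (a, b) *
    Real.log (law p g b / law p (fun ω => (f ω, g ω)) (a, b))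

/-- Conditional mutual information
`I(f ; g | h) = ∑ p(a, b, c) log (p(a, b, c) p(c) / (p(a, c) p(b, c)))`, with `0 log _ = 0`. -/
noncomputable def condMutualInfo [Fintype Ω] [Fintype α] [Fintype β] [Fintype γ]
    (p : Ω → ℝ) (f : Ω → α) (g : Ω → β) (h : Ω → γ) : ℝ :=
  ∑ a, ∑ b, ∑ c, law p (fun ω => (f ω, g ω, h ω)) (a, b, c) *
    Real.log (law p (fun ω => (f ω, g ω, h ω)) (a, b, c) * law p h c /
      (law p (fun ω => (f ω, h ω)) (a, c) * law p (fun ω => (g ω, h ω)) (b, c)))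

end Information

section Network

variable {K : ℕ}

/-- The subtuple `x_A` of a tuple `x` of channel inputs. -/
def sub {X : Fin (K + 1) → Type*} (A : Finset (Fin (K + 1))) (x : ∀ j, X j) :
    ∀ j : {j // j ∈ A}, X j.1 :=
  fun j => x j.1

/-- An `(m, n)` joint source-channel code.  The relay indexed by `k : Fin K` is terminal `k + 1`.
At time `t` (counted from `0`) it has seen the `t` previous channel outputs. -/
structure Code (S : Fin (K + 2) → Type*) (X Y : Fin (K + 1) → Type*) (m n : ℕ) where
  /-- the encoder of the source terminal -/
  enc : (Fin m → S 0) → Fin n → X 0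
  /-- the causal encoders of the relays -/
  relay : ∀ (k : Fin K) (t : Fin n), (Fin t.1 → Y k.castSucc) →
    (Fin m → S k.succ.castSucc) → X k.succ
  /-- the decoder of the destination -/
  dec : (Fin n → Y (Fin.last K)) → (Fin m → S (Fin.last (K + 1))) → Fin m → S 0

variable {S : Fin (K + 2) → Type*} {X Y : Fin (K + 1) → Type*} {m n : ℕ}

/-- The channel inputs at time `t`, when `s` is the block of source and side information symbols
and `y` is the block of channel outputs (of which only those before time `t` are used). -/
def Code.input (c : Code S X Y m n) (s : Fin m → ∀ i, S i) (y : Fin n → ∀ v, Y v) (t : Fin n) :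
    ∀ j, X j :=
  Fin.cases (c.enc (fun l => s l 0) t)
    (fun k => c.relay k t (fun u => y (Fin.castLE t.2.le u) k.castSucc)
      (fun l => s l k.succ.castSucc))

/-- The joint probability of the block `s` of i.i.d. source and side information symbols and the
block `y` of outputs of the memoryless channel `W`, when the code `c` is used. -/
def Code.prob (c : Code S X Y m n) (pS : (∀ i, S i) → ℝ) (W : (∀ j, X j) → (∀ v, Y v) → ℝ)
    (s : Fin m → ∀ i, S i) (y : Fin n → ∀ v, Y v) : ℝ :=
  (∏ l, pS (s l)) * ∏ t, W (c.input s y t) (y t)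

open Classical in
/-- The probability that the destination's estimate differs from the source block. -/
noncomputable def Code.errorProb [∀ i, Fintype (S i)] [∀ v, Fintype (Y v)]
    (c : Code S X Y m n) (pS : (∀ i, S i) → ℝ) (W : (∀ j, X j) → (∀ v, Y v) → ℝ) : ℝ :=
  ∑ s : Fin m → ∀ i, S i, ∑ y : Fin n → ∀ v, Y v,
    if c.dec (fun t => y t (Fin.last K)) (fun l => s l (Fin.last (K + 1))) ≠ (fun l => s l 0)
    then c.prob pS W s y else 0

/-- The source-channel code rate `r` (source samples per channel use) is achievable: there is a
sequence of `(m, n)` codes with `m / n ≥ r`, `m, n → ∞`, and vanishing error probability. -/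
def Achievable [∀ i, Fintype (S i)] [∀ v, Fintype (Y v)]
    (pS : (∀ i, S i) → ℝ) (W : (∀ j, X j) → (∀ v, Y v) → ℝ) (r : ℝ) : Prop :=
  ∃ (m n : ℕ → ℕ) (c : ∀ q, Code S X Y (m q) (n q)),
    (∀ q, 0 < n q ∧ r ≤ (m q : ℝ) / (n q : ℝ)) ∧
    Filter.Tendsto m Filter.atTop Filter.atTop ∧
    Filter.Tendsto n Filter.atTop Filter.atTop ∧
    Filter.Tendsto (fun q => (c q).errorProb pS W) Filter.atTop (nhds 0)

/-- The joint probability mass function of channel inputs and outputs. -/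
def jointLaw (pX : (∀ j, X j) → ℝ) (W : (∀ j, X j) → (∀ v, Y v) → ℝ) :
    (∀ j, X j) × (∀ v, Y v) → ℝ :=
  fun xy => pX xy.1 * W xy.1 xy.2

variable {N : ℕ}

/-- The transmitters `π(0), …, π(i - 1)`. -/
def before (π : Fin (N + 1) → Fin (K + 2)) (i : Fin (N + 1)) : Finset (Fin (K + 1)) :=
  {j | ∃ l, l < i ∧ π l = j.castSucc}

/-- The transmitters `π(i), …, π(N - 1)` (if `π(N)` is the destination, it is no transmitter). -/
def after (π : Fin (N + 1) → Fin (K + 2)) (i : Fin (N + 1)) : Finset (Fin (K + 1)) :=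
  {j | ∃ l, i ≤ l ∧ π l = j.castSucc}

/-- All cooperating transmitters `π(0), …, π(N - 1)`. -/
def cooperating (π : Fin (N + 1) → Fin (K + 2)) : Finset (Fin (K + 1)) :=
  {j | ∃ l, π l = j.castSucc}

/-- The inputs of the transmitters in `A` are independent of the other inputs. -/
def IndepOfRest [∀ j, Fintype (X j)] (pX : (∀ j, X j) → ℝ) (A : Finset (Fin (K + 1))) : Prop :=
  ∀ x, pX x = law pX (sub A) (sub A x) * law pX (sub Aᶜ) (sub Aᶜ x)

/-- The conditional entropy `H(S_0 | S_i)`. -/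
noncomputable def sourceEntropy [∀ i, Fintype (S i)] (pS : (∀ i, S i) → ℝ) (i : Fin (K + 2)) : ℝ :=
  condEntropy pS (fun s => s 0) (fun s => s i)

/-- `I(X_{π(0:i-1)} ; Y | X_{π(i:N-1)})`, where `Y` is the channel output indexed by `v`. -/
noncomputable def rateInfo [∀ j, Fintype (X j)] [∀ v, Fintype (Y v)]
    (pX : (∀ j, X j) → ℝ) (W : (∀ j, X j) → (∀ v, Y v) → ℝ)
    (π : Fin (N + 1) → Fin (K + 2)) (i : Fin (N + 1)) (v : Fin (K + 1)) : ℝ :=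
  condMutualInfo (jointLaw pX W) (fun xy => sub (before π i) xy.1) (fun xy => xy.2 v)
    (fun xy => sub (after π i) xy.1)

end Network

end RelayNetwork

/-! The proof is decode-and-forward with random coding and sliding-window decoding. The source is
cut into `B` blocks, sent in `B + N` channel blocks. The terminal `π i` has level `i`; in channel
block `β`, level `l < N` carries source block `β - l`, so source block `b` is carried by level `k`
in channel block `b + k`. A receiver of level `i` decodes `b` after the channel blocks `b, …, b + i
- 1`, just in time to send it in block `b + i`. Levels above `k` then carry blocks already decoded;
levels below `k` act as noise.

The letters of different levels are independent. To produce a correlated input law, a letter is a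
random strategy: a function that maps the inputs chosen by the higher levels to the next input,
drawn from the conditional law. Level `N` carries no message and supplies the inputs of the
terminals outside `π`; independence makes the resulting tuple have law `pX` (`sum_strategies`).

A receiver ranks candidates by a score: the conditional probability of the block given the side
information, times the ratios `P(y | x_{k:N-1}) / P(y | x_{k+1:N-1})` over its window. A wrong
candidate uses unsent letters, independent of the output, so each ratio has mean at most one and the
mean scores of all wrong candidates sum to at most one. For the true block the mean log score per
channel use is `I - r H > 0`, by the chain rule (`rateInfo_eq`). Hence some negative moment of the
true score decays exponentially (`exists_negMoment_decay`). With threshold `exp (δ n)`, Markov's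
inequality bounds the probability that the true block is rejected and the probability that a wrong
one is accepted (`Valid.sum_badTerm_le`).

The feedback from decoding errors into the relays' inputs is removed by comparison with ideal
inputs, for which all terminals know the true blocks (`errorProb_le`). For fixed `B` the error
vanishes as `n → ∞`, and the rate loss `B / (B + N)` is absorbed by starting from a slightly larger
rate. -/

namespace RelayNetwork

/-! ### Product measures, causal kernels and the averaging argument -/

section FiniteProbability

/-- Marginalization of a product of probability mass functions along an injection. -/
theorem sum_prod_mul_comp {I J V : Type*} [Fintype I] [DecidableEq I] [Fintype J] [DecidableEq J]
    [Fintype V] (q : I → V → ℝ) (hq : ∀ i, ∑ v, q i v = 1) (e : J → I)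
    (he : Function.Injective e) (F : (J → V) → ℝ) :
    ∑ C : I → V, (∏ i, q i (C i)) * F (C ∘ e) = ∑ v : J → V, (∏ j, q (e j) (v j)) * F v := by
  classical
  have key : ∀ v : J → V, ∑ C : I → V, (∏ i, q i (C i)) * (if C ∘ e = v then 1 else 0)
      = ∏ j, q (e j) (v j) := by
    intro v
    have h1 : ∀ C : I → V, (∏ i, q i (C i)) * (if C ∘ e = v then (1 : ℝ) else 0)
        = ∏ i, (if ∀ j, e j = i → C i = v j then q i (C i) else 0) := by
      intro C
      rw [Finset.prod_ite_zero]
      have : (C ∘ e = v) ↔ ∀ i ∈ Finset.univ, ∀ j, e j = i → C i = v j := by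
        constructor
        · rintro rfl i - j rfl; rfl
        · intro h; funext j; exact h (e j) (Finset.mem_univ _) j rfl
      by_cases hc : C ∘ e = v
      · rw [if_pos hc, if_pos (this.1 hc), mul_one]
      · rw [if_neg hc, if_neg (fun h => hc (this.2 h)), mul_zero]
    rw [Finset.sum_congr rfl fun C _ => h1 C,
      ← Fintype.prod_sum (fun i (c : V) => if ∀ j, e j = i → c = v j then q i c else 0)]
    symm
    apply Fintype.prod_of_injective e he
    · intro i hi
      rw [← hq i]
      refine Finset.sum_congr rfl fun c _ => if_pos ?_
      intro j hj
      exact absurd ⟨j, hj⟩ hi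
    · intro j
      have : ∀ c : V, (if ∀ j', e j' = e j → c = v j' then q (e j) c else 0)
          = if c = v j then q (e j) c else 0 := by
        intro c
        congr 1
        apply propext
        constructor
        · intro h; exact h j rfl
        · rintro rfl j' hj'; rw [he hj']
      simp [this]
  calc ∑ C : I → V, (∏ i, q i (C i)) * F (C ∘ e)
      = ∑ C : I → V, ∑ v : J → V, (∏ i, q i (C i)) * (if C ∘ e = v then 1 else 0) * F v := by
        refine Finset.sum_congr rfl fun C _ => ?_
        simp
    _ = ∑ v : J → V, (∏ j, q (e j) (v j)) * F v := by
        rw [Finset.sum_comm]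
        refine Finset.sum_congr rfl fun v _ => ?_
        rw [← key v, Finset.sum_mul]

theorem sum_prod_eq_one {I : Type*} {V : I → Type*} [Fintype I] [DecidableEq I]
    [∀ i, Fintype (V i)] (q : ∀ i, V i → ℝ) (hq : ∀ i, ∑ v, q i v = 1) :
    ∑ C : ∀ i, V i, ∏ i, q i (C i) = 1 := by
  rw [← Fintype.prod_sum]
  simp [hq]

/-- The law of a product sequence, evaluated through one coordinate. -/
theorem sum_prod_mul_apply {I V : Type*} [Fintype I] [DecidableEq I] [Fintype V]
    (q : I → V → ℝ) (hq : ∀ i, ∑ v, q i v = 1) (i : I) (F : V → ℝ) :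
    ∑ C : I → V, (∏ i, q i (C i)) * F (C i) = ∑ v, q i v * F v := by
  have := sum_prod_mul_comp q hq (fun _ : Unit => i) (fun _ _ _ => rfl) (fun v => F (v ()))
  simp only [Function.comp_apply, Finset.univ_unique, Finset.prod_singleton] at this
  rw [this]
  exact Fintype.sum_equiv (Equiv.funUnique Unit V) _ _ (fun v => rfl)

/-- A causal sequence of kernels has total mass one. -/
theorem sum_prod_causal {Z : Type*} [Fintype Z] [Nonempty Z] (n : ℕ)
    (k : Fin n → (Fin n → Z) → Z → ℝ) (hk : ∀ t y, ∑ z, k t y z = 1)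
    (hc : ∀ t y y', (∀ u, u < t → y u = y' u) → k t y = k t y') :
    ∑ y : Fin n → Z, ∏ t, k t y (y t) = 1 := by
  induction n with
  | zero => simp
  | succ n ih =>
    obtain ⟨z₀⟩ := ‹Nonempty Z›
    rw [← Fintype.sum_equiv (Fin.snocEquiv (fun _ => Z)) (fun p => ∏ t, k t
      (Fin.snocEquiv (fun _ => Z) p) (Fin.snocEquiv (fun _ => Z) p t)) _ (fun _ => rfl),
      Fintype.sum_prod_type, Finset.sum_comm]
    -- By causality no kernel depends on the last symbol, so it may be frozen at `z₀`; the last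
    -- kernel then sums to one and the others form a causal sequence of length `n`.
    have hz : ∀ (y : Fin n → Z) (z : Z) (t : Fin n),
        k t.castSucc (Fin.snoc (α := fun _ => Z) y z)
          = k t.castSucc (Fin.snoc (α := fun _ => Z) y z₀) := by
      intro y z t
      apply hc
      intro u hu
      have hu' : u.1 < n := lt_trans hu t.2
      obtain ⟨u, rfl⟩ : ∃ u' : Fin n, u = u'.castSucc := ⟨⟨u.1, hu'⟩, rfl⟩
      simp
    have hl : ∀ (y : Fin n → Z) (z : Z),
        k (Fin.last n) (Fin.snoc (α := fun _ => Z) y z)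
          = k (Fin.last n) (Fin.snoc (α := fun _ => Z) y z₀) := by
      intro y z
      apply hc
      intro u hu
      obtain ⟨u, rfl⟩ : ∃ u' : Fin n, u = u'.castSucc := ⟨⟨u.1, hu⟩, rfl⟩
      simp
    have := ih (fun t y => k t.castSucc (Fin.snoc (α := fun _ => Z) y z₀))
      (fun t y => hk _ _) (by
        intro t y y' h
        apply hc
        intro u hu
        have hu' : u.1 < n := lt_trans hu t.2
        obtain ⟨u, rfl⟩ : ∃ u' : Fin n, u = u'.castSucc := ⟨⟨u.1, hu'⟩, rfl⟩
        simpa using h u (by simpa using hu))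
    rw [← this]
    refine Finset.sum_congr rfl fun y _ => ?_
    calc _ = ∑ z, (∏ t : Fin n, k t.castSucc (Fin.snoc (α := fun _ => Z) y z₀) (y t)) *
          k (Fin.last n) (Fin.snoc (α := fun _ => Z) y z₀) z := by
          refine Finset.sum_congr rfl fun z _ => ?_
          rw [Fin.prod_univ_castSucc]
          simp only [Fin.snocEquiv, Equiv.coe_fn_mk, Fin.snoc_castSucc, Fin.snoc_last, hl y z]
          congr 1
          exact Finset.prod_congr rfl fun t _ => by rw [hz y z t]
      _ = _ := by rw [← Finset.mul_sum, hk, mul_one]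

theorem exists_le_of_sum_mul_le {Ω : Type*} [Fintype Ω] (p f : Ω → ℝ) (hp : ∀ ω, 0 ≤ p ω)
    (hs : ∑ ω, p ω = 1) {ε : ℝ} (h : ∑ ω, p ω * f ω ≤ ε) : ∃ ω, f ω ≤ ε := by
  by_contra! hc
  have hpos : ∃ ω, 0 < p ω := by
    by_contra! hn
    have : ∑ ω, p ω ≤ 0 := Finset.sum_nonpos fun ω _ => hn ω
    linarith
  obtain ⟨ω₀, h₀⟩ := hpos
  have : ∑ ω, p ω * ε < ∑ ω, p ω * f ω :=
    Finset.sum_lt_sum (fun ω _ => mul_le_mul_of_nonneg_left (hc ω).le (hp ω))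
      ⟨ω₀, Finset.mem_univ _, mul_lt_mul_of_pos_left (hc ω₀) h₀⟩
  rw [← Finset.sum_mul, hs, one_mul] at this
  linarith

end FiniteProbability

/-! ### Exponential decay of negative moments -/

section NegativeMoments

variable {Ω : Type*} [Fintype Ω]

/-- The moment `E[f ^ (-s)]`. -/
noncomputable def negMoment (p f : Ω → ℝ) (s : ℝ) : ℝ := ∑ ω, p ω * f ω ^ (-s)

theorem negMoment_zero (p f : Ω → ℝ) : negMoment p f 0 = ∑ ω, p ω := by
  simp [negMoment]

theorem negMoment_pos (p f : Ω → ℝ) (hp : ∀ ω, 0 ≤ p ω) (hs : ∑ ω, p ω = 1)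
    (hf : ∀ ω, 0 < p ω → 0 < f ω) (s : ℝ) : 0 < negMoment p f s := by
  have h0 : ∀ ω, 0 ≤ p ω * f ω ^ (-s) := by
    intro ω
    rcases (hp ω).eq_or_lt with h | h
    · simp [← h]
    · exact mul_nonneg h.le (Real.rpow_nonneg (hf ω h).le _)
  have hpos : ∃ ω, 0 < p ω := by
    by_contra! hn
    have : ∑ ω, p ω ≤ 0 := Finset.sum_nonpos fun ω _ => hn ω
    linarith
  obtain ⟨ω₀, h₀⟩ := hpos
  exact Finset.sum_pos' (fun ω _ => h0 ω)
    ⟨ω₀, Finset.mem_univ _, mul_pos h₀ (Real.rpow_pos_of_pos (hf _ h₀) _)⟩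

/-- The derivative at exponent zero turns a statement about the mean of `log f` into one about
moments. Outcomes of probability zero drop out, so positivity is needed only on the support. -/
theorem hasDerivAt_negMoment (p f : Ω → ℝ) (hp : ∀ ω, 0 ≤ p ω)
    (hf : ∀ ω, 0 < p ω → 0 < f ω) :
    HasDerivAt (negMoment p f) (-∑ ω, p ω * Real.log (f ω)) 0 := by
  rw [← Finset.sum_neg_distrib]
  refine HasDerivAt.fun_sum fun ω _ => ?_
  rcases (hp ω).eq_or_lt with h | h
  · simpa [← h] using hasDerivAt_const (0 : ℝ) (0 : ℝ)
  · have := ((hasDerivAt_neg (0 : ℝ)).const_rpow (hf ω h)).const_mul (p ω)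
    have e : p ω * (Real.log (f ω) * -1 * f ω ^ (-(0 : ℝ))) = -(p ω * Real.log (f ω)) := by
      simp
    exact e ▸ this

theorem exists_pos_lt_of_hasDerivAt_neg {g : ℝ → ℝ} {g' : ℝ} (h : HasDerivAt g g' 0)
    (h0 : g 0 = 0) (hg : g' < 0) : ∃ s, 0 < s ∧ g s < 0 := by
  have h1 := (hasDerivAt_iff_tendsto_slope.1 h).mono_left
    (nhdsWithin_mono (0 : ℝ) (fun x (hx : x ∈ Set.Ioi 0) => ne_of_gt hx))
  have h2 := (h1.eventually (gt_mem_nhds hg)).and self_mem_nhdsWithin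
  obtain ⟨s, hs, hs0⟩ := h2.exists
  refine ⟨s, hs0, ?_⟩
  have hs0' : (0 : ℝ) < s := hs0
  rw [slope_def_field, h0, sub_zero, sub_zero, div_lt_iff₀ hs0', zero_mul] at hs
  exact hs

/-- Positive drift of the logarithms makes some negative moment decay. -/
theorem exists_negMoment_decay {Ω' : Type*} [Fintype Ω'] (r : ℝ) (p f : Ω → ℝ)
    (hp : ∀ ω, 0 ≤ p ω) (hs : ∑ ω, p ω = 1) (hf : ∀ ω, 0 < p ω → 0 < f ω)
    (i : ℕ) (p' : Ω' → ℝ) (f' : ℕ → Ω' → ℝ)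
    (hp' : ∀ ω, 0 ≤ p' ω) (hs' : ∑ ω, p' ω = 1) (hf' : ∀ k < i, ∀ ω, 0 < p' ω → 0 < f' k ω)
    (hd : 0 < r * ∑ ω, p ω * Real.log (f ω) +
      ∑ k ∈ Finset.range i, ∑ ω, p' ω * Real.log (f' k ω)) :
    ∃ s, 0 < s ∧ r * Real.log (negMoment p f s) +
      ∑ k ∈ Finset.range i, Real.log (negMoment p' (f' k) s) < 0 := by
  have h1 := ((hasDerivAt_negMoment p f hp hf).log
    (negMoment_pos p f hp hs hf 0).ne').const_mul r
  have h2 : ∀ k ∈ Finset.range i, HasDerivAt (fun s => Real.log (negMoment p' (f' k) s))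
      (-∑ ω, p' ω * Real.log (f' k ω)) 0 := by
    intro k hk
    have hk' := hf' k (Finset.mem_range.1 hk)
    have := (hasDerivAt_negMoment p' (f' k) hp' hk').log
      (negMoment_pos p' (f' k) hp' hs' hk' 0).ne'
    simpa [negMoment_zero, hs'] using this
  refine exists_pos_lt_of_hasDerivAt_neg (h1.add (HasDerivAt.fun_sum h2)) ?_ ?_
  · simp [negMoment_zero, hs, hs']
  · simp only [negMoment_zero, hs, div_one, Finset.sum_neg_distrib]
    linarith

end NegativeMoments

/-! ### Successive decoding and the block structure -/

section Successive

variable {M : Type*} [Nonempty M]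

/-- Successive decoding: the estimate of block `b` is a message accepted by the test `P b`, which
is given the estimates of the previous blocks; blocks not yet decoded have the value `d`. -/
noncomputable def successive (P : ℕ → (ℕ → M) → M → Prop) (d : M) : ℕ → ℕ → M
  | 0 => fun _ => d
  | b + 1 => Function.update (successive P d b) b (Classical.epsilon (P b (successive P d b)))

theorem successive_congr {P P' : ℕ → (ℕ → M) → M → Prop} (d : M) (b : ℕ)
    (h : ∀ b' < b, P b' = P' b') : successive P d b = successive P' d b := by
  induction b with
  | zero => rfl
  | succ b ih =>
    have := ih fun b' hb' => h b' (by omega)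
    simp only [successive, this, h b (Nat.lt_succ_self b)]

/-- Tests that are right when given the true past suffice: inductively the estimated past is the
true one, so the test sees the same data, and the choice operator can only pick the unique accepted
message. -/
theorem successive_eq {P : ℕ → (ℕ → M) → M → Prop} (d : M) (w : ℕ → M) (B : ℕ)
    (hc : ∀ b w w', (∀ b' < b, w b' = w' b') → P b w = P b w')
    (hP : ∀ b < B, ∀ x, P b w x ↔ x = w b) (b : ℕ) (hb : b ≤ B) (b' : ℕ) :
    successive P d b b' = if b' < b then w b' else d := by
  induction b generalizing b' with
  | zero => simp [successive]
  | succ b ih =>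
    have ih' := ih (by omega)
    have h1 : P b (successive P d b) = P b w := by
      apply hc
      intro b' hb'
      rw [ih' b', if_pos hb']
    have h2 : Classical.epsilon (P b w) = w b :=
      (hP b (by omega) _).1 (Classical.epsilon_spec ⟨w b, (hP b (by omega) _).2 rfl⟩)
    by_cases e : b' = b
    · subst e
      simp [successive, h1, h2]
    · have : (b' < b + 1) ↔ b' < b := by omega
      simp [successive, e, ih' b', this]

end Successive

section Blocks

/-- The `b`-th block of a sequence of `B` blocks of length `m`; constant beyond the last block. -/
def block {α : Type*} {B m : ℕ} (d : α) (s : Fin (B * m) → α) (b : ℕ) : Fin m → α :=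
  fun j => if h : b < B then s (finProdFinEquiv (⟨b, h⟩, j)) else d

/-- Extend a sequence of past symbols by a constant. -/
def extend {α : Type*} {t : ℕ} (T : ℕ) (d : α) (y : Fin t → α) : Fin T → α :=
  fun u => if h : u.1 < t then y ⟨u.1, h⟩ else d

/-- The message carried by level `l` in the channel block `β`: the source block `β - l`.  Level `N`
carries no message. -/
def levelMsg {M : Type*} (N : ℕ) (d : M) (w : ℕ → M) (β : ℕ) (l : Fin (N + 1)) : M :=
  if l.1 < N ∧ l.1 ≤ β then w (β - l.1) else d

/-- The letters of all levels at time `t`, with codebook `C` and channel blocks of length `n`. -/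
def word {M V : Type*} {N T : ℕ} (n : ℕ) (C : Fin T → Fin (N + 1) × M → V) (d : M) (w : ℕ → M)
    (t : Fin T) : Fin (N + 1) → V :=
  fun l => C t (l, levelMsg N d w (t.1 / n) l)

end Blocks

/-! ### Abstract decode-and-forward schemes and their codes -/

section Scheme

variable {K : ℕ}

/-- A decode-and-forward scheme with `N + 1` levels.  The terminals of level `i` know the letters of
the levels `≥ i`.  The receiver `u` (terminal `u + 1`) ranks candidate source blocks by the product
of `sideScore` over the side information and `chanScore` over a window of channel blocks. -/
structure Scheme (S : Fin (K + 2) → Type*) (X Y : Fin (K + 1) → Type*) (N : ℕ) (V : Type*) where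
  /-- the law of the letters of each level -/
  letterLaw : Fin (N + 1) → V → ℝ
  /-- the channel inputs as functions of the letters of all levels -/
  inputMap : (Fin (N + 1) → V) → ∀ j, X j
  /-- the level of each terminal -/
  level : Fin (K + 2) → ℕ
  level_zero : level 0 = 0
  level_last : level (Fin.last (K + 1)) = N
  inputMap_congr : ∀ (j : Fin (K + 1)) v v',
    (∀ l : Fin (N + 1), level j.castSucc ≤ l.1 → v l = v' l) → inputMap v j = inputMap v' j
  /-- the score of a source symbol, given a symbol of the side information -/
  sideScore : ∀ u : Fin (K + 1), S 0 → S u.succ → ℝ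
  /-- the score of the letter of level `k`, given the letters of higher levels and an output -/
  chanScore : ∀ u : Fin (K + 1), ℕ → (Fin (N + 1) → V) → Y u → ℝ
  chanScore_congr : ∀ u (k : ℕ) v v' y,
    (∀ l : Fin (N + 1), k ≤ l.1 → v l = v' l) → chanScore u k v y = chanScore u k v' y

variable {S : Fin (K + 2) → Type*} {X Y : Fin (K + 1) → Type*} {N : ℕ} {V : Type*}

namespace Scheme

variable (A : Scheme S X Y N V)

/-- The receivers that have to decode. -/
def Active (u : Fin (K + 1)) : Prop := u = Fin.last K ∨ A.level u.succ < N

variable {B m n : ℕ} (C : Fin ((B + N) * n) → Fin (N + 1) × (Fin m → S 0) → V)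
  (d : ∀ i, S i)

/-- The score of the candidate `c` for the source block `b`, given the other blocks `w`. -/
noncomputable def score (u : Fin (K + 1)) (σ : ℕ → Fin m → S u.succ)
    (y : Fin ((B + N) * n) → Y u) (b : ℕ) (w : ℕ → Fin m → S 0) (c : Fin m → S 0) : ℝ :=
  (∏ j, A.sideScore u (c j) (σ b j)) *
    -- Channel block `b + k` carries source block `b` on level `k`; a receiver of level `i` uses the
    -- blocks with `k < i`, that is, the transmissions of the levels below its own.
    ∏ t : Fin ((B + N) * n), if b ≤ t.1 / n ∧ t.1 / n < b + A.level u.succ then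
      A.chanScore u (t.1 / n - b) (word n C (fun _ => d 0) (Function.update w b c) t) (y t) else 1

/-- In channel block `b + k` the levels above `k` carry source blocks before `b`, level `k` carries
the candidate, and the score ignores lower levels. So future source blocks never enter. -/
theorem score_congr_blocks (u : Fin (K + 1)) (σ : ℕ → Fin m → S u.succ)
    (y : Fin ((B + N) * n) → Y u) (b : ℕ) (w w' : ℕ → Fin m → S 0)
    (h : ∀ b' < b, w b' = w' b') (c : Fin m → S 0) :
    A.score C d u σ y b w c = A.score C d u σ y b w' c := by
  unfold score
  congr 1
  refine Finset.prod_congr rfl fun t _ => ?_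
  split_ifs with ht
  · apply A.chanScore_congr
    intro l hl
    unfold word levelMsg
    split_ifs with h1
    · by_cases e : t.1 / n - l.1 = b
      · simp [e]
      · rw [Function.update_of_ne e, Function.update_of_ne e, h _ (by omega)]
    · rfl
  · rfl

theorem score_congr_outputs (u : Fin (K + 1)) (σ : ℕ → Fin m → S u.succ)
    (y y' : Fin ((B + N) * n) → Y u) (b : ℕ)
    (h : ∀ t : Fin ((B + N) * n), t.1 / n < b + A.level u.succ → y t = y' t)
    (w : ℕ → Fin m → S 0) (c : Fin m → S 0) :
    A.score C d u σ y b w c = A.score C d u σ y' b w c := by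
  unfold score
  congr 1
  refine Finset.prod_congr rfl fun t _ => ?_
  split_ifs with ht
  · rw [h t ht.2]
  · rfl

variable (θ : Fin (K + 1) → ℝ)

/-- The acceptance test of the receiver `u`. -/
def Accept (u : Fin (K + 1)) (σ : ℕ → Fin m → S u.succ)
    (y : Fin ((B + N) * n) → Y u) (b : ℕ) (w : ℕ → Fin m → S 0) (c : Fin m → S 0) : Prop :=
  θ u ≤ A.score C d u σ y b w c

/-- The estimates of the first `b` source blocks at the receiver `u`. -/
noncomputable def estimate (u : Fin (K + 1)) (s : Fin (B * m) → S u.succ)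
    (y : Fin ((B + N) * n) → Y u) (b : ℕ) : ℕ → Fin m → S 0 :=
  haveI : Nonempty (Fin m → S 0) := ⟨fun _ => d 0⟩
  successive (A.Accept C d θ u (block (d u.succ) s) y) (fun _ => d 0) b

/-- The code of the scheme with codebook `C` and thresholds `θ`. -/
noncomputable def code (y₀ : ∀ u, Y u) : Code S X Y (B * m) ((B + N) * n) where
  enc s t := A.inputMap (word n C (fun _ => d 0) (block (d 0) s) t) 0
  -- In channel block `β` a relay of level `i` needs source blocks up to `β - i`, that is, the first
  -- `β + 1 - i`. Their windows end before block `β`, so the filler `y₀` for unseen outputs is never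
  -- read.
  relay k t y s := A.inputMap (word n C (fun _ => d 0)
    (A.estimate C d θ k.castSucc s (extend _ (y₀ k.castSucc) y)
      (min B (t.1 / n + 1 - A.level k.castSucc.succ))) t) k.succ
  dec y s l := A.estimate C d θ (Fin.last K) s y B (finProdFinEquiv.symm l).1
    (finProdFinEquiv.symm l).2

/-- Every receiver that has to decode accepts exactly the true source blocks. -/
def Good (s : Fin (B * m) → ∀ i, S i) (y : Fin ((B + N) * n) → ∀ u, Y u) : Prop :=
  ∀ u, A.Active u → ∀ b < B, ∀ c,
    A.Accept C d θ u (block (d u.succ) fun l => s l u.succ) (fun t => y t u) b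
      (block (d 0) fun l => s l 0) c ↔ c = block (d 0) (fun l => s l 0) b

/-- The inputs when every terminal knows the source blocks of its level. -/
def idealInput (s : Fin (B * m) → ∀ i, S i) (t : Fin ((B + N) * n)) : ∀ j, X j :=
  A.inputMap (word n C (fun _ => d 0) (block (d 0) fun l => s l 0) t)

variable {A C d θ}

theorem Good.estimate_eq {s : Fin (B * m) → ∀ i, S i} {y : Fin ((B + N) * n) → ∀ u, Y u}
    (h : A.Good C d θ s y) {u : Fin (K + 1)} (hu : A.Active u) {b : ℕ} (hb : b ≤ B) (b' : ℕ) :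
    A.estimate C d θ u (fun l => s l u.succ) (fun t => y t u) b b' =
      if b' < b then block (d 0) (fun l => s l 0) b' else fun _ => d 0 := by
  unfold estimate
  have : Nonempty (Fin m → S 0) := ⟨fun _ => d 0⟩
  refine successive_eq _ _ B ?_ ?_ b hb b'
  · intro b w w' hw
    funext c
    unfold Accept
    rw [A.score_congr_blocks C d u _ _ b w w' hw c]
  · intro b hb c
    exact h u hu b hb c

theorem estimate_congr (u : Fin (K + 1)) (s : Fin (B * m) → S u.succ)
    (y y' : Fin ((B + N) * n) → Y u) (b : ℕ)
    (h : ∀ t : Fin ((B + N) * n), t.1 / n + 1 < b + A.level u.succ → y t = y' t) :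
    A.estimate C d θ u s y b = A.estimate C d θ u s y' b := by
  unfold estimate
  have : Nonempty (Fin m → S 0) := ⟨fun _ => d 0⟩
  apply successive_congr
  intro b' hb'
  funext w c
  unfold Accept
  rw [A.score_congr_outputs C d u _ y y' b' (fun t ht => h t (by omega)) w c]

/-- This breaks the circularity between relay errors and channel outputs: `Good` refers only to
tests with the true past, yet it forces the actual inputs to be the ideal ones. A relay whose
letters carry messages has level below `N`, hence is active and decodes correctly. -/
theorem Good.input_eq {s : Fin (B * m) → ∀ i, S i} {y : Fin ((B + N) * n) → ∀ u, Y u}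
    (h : A.Good C d θ s y) (y₀ : ∀ u, Y u) (t : Fin ((B + N) * n)) :
    (A.code C d θ y₀).input s y t = A.idealInput C d s t := by
  funext j
  refine Fin.cases ?_ (fun k => ?_) j
  · rfl
  · change A.inputMap (word n C (fun _ => d 0) (A.estimate C d θ k.castSucc
      (fun l => s l k.castSucc.succ) (extend _ (y₀ k.castSucc)
        (fun u : Fin t.1 => y (Fin.castLE t.2.le u) k.castSucc))
      (min B (t.1 / n + 1 - A.level k.castSucc.succ))) t) k.succ
      = A.inputMap (word n C (fun _ => d 0) (block (d 0) fun l => s l 0) t) k.succ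
    apply A.inputMap_congr
    intro l hl
    change A.level k.castSucc.succ ≤ l.1 at hl
    unfold word levelMsg
    split_ifs with h1
    · have hact : A.Active k.castSucc := Or.inr (lt_of_le_of_lt hl h1.1)
      rw [estimate_congr (A := A) (C := C) (d := d) (θ := θ) k.castSucc
        (fun l => s l k.castSucc.succ) _ (fun t => y t k.castSucc), h.estimate_eq hact (by omega)]
      · split_ifs with h2
        · rfl
        -- Past the last source block both sides are the default symbol, by the convention in
        -- `block`.
        · have : ¬ (t.1 / n - l.1 < B) := by omega
          congr 2
          funext j
          simp [block, this]
      · intro u hu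
        have hlt : u.1 < t.1 := by
          by_contra! hc
          have := Nat.div_le_div_right (c := n) hc
          omega
        simp only [extend, hlt, dif_pos]
        rfl
    · rfl

theorem Good.dec_eq {s : Fin (B * m) → ∀ i, S i} {y : Fin ((B + N) * n) → ∀ u, Y u}
    (h : A.Good C d θ s y) (y₀ : ∀ u, Y u) :
    (A.code C d θ y₀).dec (fun t => y t (Fin.last K)) (fun l => s l (Fin.last (K + 1)))
      = fun l => s l 0 := by
  funext l
  change A.estimate C d θ (Fin.last K) (fun l => s l (Fin.last K).succ) (fun t => y t (Fin.last K))
    B (finProdFinEquiv.symm l).1 (finProdFinEquiv.symm l).2 = s l 0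
  rw [h.estimate_eq (Or.inl rfl) le_rfl, if_pos (Fin.is_lt _)]
  simp only [block, Fin.is_lt, dif_pos, Fin.eta, Prod.mk.eta, Equiv.apply_symm_apply]

end Scheme

end Scheme

theorem prod_time_blocks {L n : ℕ} (g : ℕ → ℝ) :
    ∏ t : Fin (L * n), g (t.1 / n) = ∏ β ∈ Finset.range L, g β ^ n := by
  rw [← Fintype.prod_equiv finProdFinEquiv (fun p : Fin L × Fin n => g p.1) _ ?_,
    Fintype.prod_prod_type]
  · simp [Finset.prod_range]
  · rintro ⟨β, τ⟩
    have : (τ.1 + n * β.1) / n = β.1 := by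
      rw [Nat.add_mul_div_left _ _ (by have := τ.2; omega), Nat.div_eq_of_lt τ.2, zero_add]
    simp [this]

/-- Each channel block of the window contributes `n` equal factors; `hL` ensures that the window is
not cut off. -/
theorem prod_window {L n b i : ℕ} (hL : b + i ≤ L) (R : ℕ → ℝ) :
    ∏ t : Fin (L * n), (if b ≤ t.1 / n ∧ t.1 / n < b + i then R (t.1 / n - b) else 1)
      = (∏ k ∈ Finset.range i, R k) ^ n := by
  rw [prod_time_blocks (fun β => if b ≤ β ∧ β < b + i then R (β - b) else 1), Finset.prod_pow]
  congr 1
  rw [← Finset.prod_filter]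
  have : (Finset.range L).filter (fun β => b ≤ β ∧ β < b + i) = Finset.Ico b (b + i) := by
    ext β; simp; omega
  rw [this, Finset.prod_Ico_eq_prod_range]
  simp

/-! ### Comparison with ideal inputs; conditions on the scores -/

namespace Scheme

variable {K : ℕ} {S : Fin (K + 2) → Type*} {X Y : Fin (K + 1) → Type*} {N : ℕ} {V : Type*}
  [∀ i, Fintype (S i)] [∀ v, Fintype (Y v)]

/-- The joint law of the letters of all levels and the channel outputs. -/
def letterOutputLaw (A : Scheme S X Y N V) (W : (∀ j, X j) → (∀ v, Y v) → ℝ) :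
    (Fin (N + 1) → V) × (∀ v, Y v) → ℝ :=
  fun p => (∏ l, A.letterLaw l (p.1 l)) * W (A.inputMap p.1) p.2

variable {A : Scheme S X Y N V} {pS : (∀ i, S i) → ℝ} {W : (∀ j, X j) → (∀ v, Y v) → ℝ} {r : ℝ}
variable {B m n : ℕ}

/-- The probability of the source block and the outputs under ideal inputs. -/
def idealProb (A : Scheme S X Y N V) (pS : (∀ i, S i) → ℝ) (W : (∀ j, X j) → (∀ v, Y v) → ℝ)
    (C : Fin ((B + N) * n) → Fin (N + 1) × (Fin m → S 0) → V) (d : ∀ i, S i)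
    (s : Fin (B * m) → ∀ i, S i) (y : Fin ((B + N) * n) → ∀ u, Y u) : ℝ :=
  (∏ l, pS (s l)) * ∏ t, W (A.idealInput C d s t) (y t)

/-- On good pairs `(s, y)` the code decodes correctly and has the same probability as under ideal
inputs. Both laws have total mass one, so the error probability is at most the ideal probability of
the pairs that are not good, which `bad` dominates. -/
theorem errorProb_le (hpS : pS ∈ stdSimplex ℝ (∀ i, S i))
    (hW : ∀ x, W x ∈ stdSimplex ℝ (∀ v, Y v))
    (C : Fin ((B + N) * n) → Fin (N + 1) × (Fin m → S 0) → V) (d : ∀ i, S i)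
    (θ : Fin (K + 1) → ℝ) (y₀ : ∀ u, Y u)
    (bad : (Fin (B * m) → ∀ i, S i) → (Fin ((B + N) * n) → ∀ u, Y u) → ℝ)
    (h0 : ∀ s y, 0 ≤ A.idealProb pS W C d s y * bad s y)
    (h1 : ∀ s y, ¬ A.Good C d θ s y →
      A.idealProb pS W C d s y ≤ A.idealProb pS W C d s y * bad s y) :
    (A.code C d θ y₀).errorProb pS W ≤ ∑ s, ∑ y, A.idealProb pS W C d s y * bad s y := by
  classical
  have hs : ∑ s : Fin (B * m) → ∀ i, S i, ∏ l, pS (s l) = 1 :=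
    sum_prod_eq_one (fun _ => pS) (fun _ => hpS.2)
  have hprob : ∑ s, ∑ y, (A.code C d θ y₀).prob pS W s y = 1 := by
    rw [← hs]
    refine Finset.sum_congr rfl fun s _ => ?_
    unfold Code.prob
    rw [← Finset.mul_sum]
    have : Nonempty (∀ v, Y v) := ⟨y₀⟩
    rw [sum_prod_causal _ (fun t y z => W ((A.code C d θ y₀).input s y t) z)
      (fun t y => (hW _).2), mul_one]
    intro t y y' h
    have : (A.code C d θ y₀).input s y t = (A.code C d θ y₀).input s y' t := by
      funext j
      refine Fin.cases ?_ (fun k => ?_) j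
      · rfl
      · unfold Code.input
        simp only [Fin.cases_succ]
        congr 1
        funext u
        rw [h _ (by simp [Fin.lt_def])]
    simp only [this]
  have hideal : ∑ s, ∑ y, A.idealProb pS W C d s y = 1 := by
    rw [← hs]
    refine Finset.sum_congr rfl fun s _ => ?_
    unfold idealProb
    rw [← Finset.mul_sum, sum_prod_eq_one (fun t z => W (A.idealInput C d s t) z)
      (fun t => (hW _).2), mul_one]
  have hnn : ∀ s y, 0 ≤ (A.code C d θ y₀).prob pS W s y := fun s y =>
    mul_nonneg (Finset.prod_nonneg fun l _ => hpS.1 _) (Finset.prod_nonneg fun t _ => (hW _).1 _)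
  -- The total mass of the actual law is replaced by that of the ideal law, so that the rest is a
  -- pointwise comparison.
  have herr : (A.code C d θ y₀).errorProb pS W = ∑ s, ∑ y, A.idealProb pS W C d s y -
      ∑ s, ∑ y, (if (A.code C d θ y₀).dec (fun t => y t (Fin.last K))
        (fun l => s l (Fin.last (K + 1))) = (fun l => s l 0)
        then (A.code C d θ y₀).prob pS W s y else 0) := by
    rw [hideal, ← hprob]
    simp only [← Finset.sum_sub_distrib]
    unfold Code.errorProb
    refine Finset.sum_congr rfl fun s _ => Finset.sum_congr rfl fun y _ => ?_
    split_ifs <;> simp_all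
  rw [herr]
  simp only [← Finset.sum_sub_distrib]
  refine Finset.sum_le_sum fun s _ => Finset.sum_le_sum fun y _ => ?_
  by_cases hg : A.Good C d θ s y
  · rw [if_pos (hg.dec_eq y₀)]
    have : (A.code C d θ y₀).prob pS W s y = A.idealProb pS W C d s y := by
      unfold Code.prob idealProb
      simp only [hg.input_eq y₀]
    rw [this, sub_self]
    exact h0 s y
  · refine le_trans ?_ (h1 s y hg)
    have : 0 ≤ (if (A.code C d θ y₀).dec (fun t => y t (Fin.last K))
        (fun l => s l (Fin.last (K + 1))) = (fun l => s l 0)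
        then (A.code C d θ y₀).prob pS W s y else 0) := by
      split_ifs
      · exact hnn s y
      · exact le_rfl
    linarith

variable [Fintype V]

/-- The conditions on the scores under which the random code works for `m ≈ r n`. -/
structure Valid (A : Scheme S X Y N V) (pS : (∀ i, S i) → ℝ)
    (W : (∀ j, X j) → (∀ v, Y v) → ℝ) (r : ℝ) : Prop where
  letterLaw_nonneg : ∀ l v, 0 ≤ A.letterLaw l v
  letterLaw_sum : ∀ l, ∑ v, A.letterLaw l v = 1
  side_nonneg : ∀ u c σ, 0 ≤ A.sideScore u c σ
  side_pos : ∀ u, A.Active u → ∀ s, 0 < pS s → 0 < A.sideScore u (s 0) (s u.succ)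
  -- Only wrong blocks are summed, and only for source blocks in the support: this leaves room for
  -- scores that exceed one on the true block.
  side_sum : ∀ u, A.Active u → ∀ (m : ℕ) (s : Fin m → ∀ i, S i), (∀ l, 0 < pS (s l)) →
    ∑ c : Fin m → S 0, (open Classical in if c = fun l => s l 0 then 0 else
      ∏ l, A.sideScore u (c l) (s l u.succ)) ≤ 1
  chan_nonneg : ∀ u k v y, 0 ≤ A.chanScore u k v y
  chan_pos : ∀ u, A.Active u → ∀ k < A.level u.succ, ∀ p, 0 < A.letterOutputLaw W p →
    0 < A.chanScore u k p.1 (p.2 u)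
  chan_sum : ∀ u, A.Active u → ∀ k : Fin (N + 1), k.1 < A.level u.succ → ∀ v y,
    ∑ c, A.letterLaw k c * A.chanScore u k (Function.update v k c) y ≤ 1
  drift : ∀ u, A.Active u → 0 < r * ∑ s, pS s * Real.log (A.sideScore u (s 0) (s u.succ)) +
    ∑ k ∈ Finset.range (A.level u.succ),
      ∑ p, A.letterOutputLaw W p * Real.log (A.chanScore u k p.1 (p.2 u))

/-! ### Averages over the random codebook -/

section Average

/-- The probability of a codebook. -/
def bookLaw {M : Type*} [Fintype M] {T : ℕ} (A : Scheme S X Y N V)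
    (C : Fin T → Fin (N + 1) × M → V) : ℝ :=
  ∏ t, ∏ i, A.letterLaw i.1 (C t i)

theorem Valid.bookLaw_nonneg {M : Type*} [Fintype M] {T : ℕ} (hA : A.Valid pS W r)
    (C : Fin T → Fin (N + 1) × M → V) : 0 ≤ A.bookLaw C :=
  Finset.prod_nonneg fun _ _ => Finset.prod_nonneg fun _ _ => hA.letterLaw_nonneg _ _

theorem Valid.sum_bookLaw {M : Type*} [Fintype M] [DecidableEq M] {T : ℕ} (hA : A.Valid pS W r) :
    ∑ C : Fin T → Fin (N + 1) × M → V, A.bookLaw C = 1 := by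
  have h : ∑ c : Fin (N + 1) × M → V, ∏ i, A.letterLaw i.1 (c i) = 1 :=
    sum_prod_eq_one (V := fun _ : Fin (N + 1) × M => V)
      (fun i v => A.letterLaw i.1 v) fun i => hA.letterLaw_sum _
  unfold bookLaw
  rw [← Fintype.prod_sum (fun (_ : Fin T) (c : Fin (N + 1) × M → V) =>
    ∏ i, A.letterLaw i.1 (c i))]
  simp only [h, Finset.prod_const_one]

theorem sum_sum_prod {ι α β : Type*} [Fintype ι] [DecidableEq ι] [Fintype α] [Fintype β]
    (F : ι → α → β → ℝ) :
    ∑ C : ι → α, ∑ y : ι → β, ∏ t, F t (C t) (y t) = ∏ t, ∑ c, ∑ z, F t c z := by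
  rw [Fintype.prod_sum]
  refine Finset.sum_congr rfl fun C _ => ?_
  rw [Fintype.prod_sum]

theorem Valid.sum_letters {M : Type*} [Fintype M] [DecidableEq M]
    (hA : A.Valid pS W r) (f : Fin (N + 1) → M)
    (G : (Fin (N + 1) → V) → (∀ u, Y u) → ℝ) :
    ∑ c : Fin (N + 1) × M → V, ∑ z, (∏ i, A.letterLaw i.1 (c i)) *
      (W (A.inputMap fun l => c (l, f l)) z * G (fun l => c (l, f l)) z) =
    ∑ p, A.letterOutputLaw W p * G p.1 p.2 := by
  have := sum_prod_mul_comp (fun (i : Fin (N + 1) × M) v => A.letterLaw i.1 v)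
    (fun i => hA.letterLaw_sum _) (fun l => (l, f l)) (fun l l' h => (Prod.mk.inj h).1)
    (fun v => ∑ z, W (A.inputMap v) z * G v z)
  simp only [Finset.mul_sum] at this
  rw [Fintype.sum_prod_type]
  unfold letterOutputLaw
  simp only [mul_assoc]
  exact this

/-- Since `f k ≠ c₀`, the letter `(k, c₀)` is not among those sent, so it is independent of them and
of the output. Averaging over it first, `chan_sum` bounds the score by one. In `e`, the index `none`
stands for this extra letter. -/
theorem Valid.sum_letters_extra {M : Type*} [Fintype M] [DecidableEq M]
    (hA : A.Valid pS W r) (hW : ∀ x, W x ∈ stdSimplex ℝ (∀ v, Y v))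
    {u : Fin (K + 1)} (hu : A.Active u)
    (f : Fin (N + 1) → M) (k : Fin (N + 1)) (hk : k.1 < A.level u.succ)
    (c₀ : M) (hc : f k ≠ c₀) :
    ∑ c : Fin (N + 1) × M → V, ∑ z, (∏ i, A.letterLaw i.1 (c i)) *
      (W (A.inputMap fun l => c (l, f l)) z *
        A.chanScore u k (Function.update (fun l => c (l, f l)) k (c (k, c₀))) (z u)) ≤ 1 := by
  let e : Option (Fin (N + 1)) → Fin (N + 1) × M :=
    fun o => o.elim (k, c₀) (fun l => (l, f l))
  have he : Function.Injective e := by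
    rintro (_ | l) (_ | l') h
    · rfl
    · simp only [e, Option.elim, Prod.mk.injEq] at h
      obtain ⟨rfl, h⟩ := h
      exact absurd h.symm hc
    · simp only [e, Option.elim, Prod.mk.injEq] at h
      obtain ⟨rfl, h⟩ := h
      exact absurd h hc
    · simp only [e, Option.elim, Prod.mk.injEq] at h
      rw [h.1]
  have := sum_prod_mul_comp (fun (i : Fin (N + 1) × M) v => A.letterLaw i.1 v)
    (fun i => hA.letterLaw_sum _) e he
    (fun v => ∑ z, W (A.inputMap fun l => v (some l)) z *
      A.chanScore u k (Function.update (fun l => v (some l)) k (v none)) (z u))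
  simp only [Finset.mul_sum] at this
  refine le_of_eq_of_le this ?_
  rw [← Fintype.sum_equiv (Equiv.piOptionEquivProd (β := fun _ => V)).symm _ _ (fun _ => rfl),
    Fintype.sum_prod_type, Finset.sum_comm]
  have h1 : ∑ v : Fin (N + 1) → V, ∏ l, A.letterLaw l (v l) = 1 :=
    sum_prod_eq_one _ hA.letterLaw_sum
  rw [← h1]
  refine Finset.sum_le_sum fun v _ => ?_
  have h2 : 0 ≤ ∏ l, A.letterLaw l (v l) :=
    Finset.prod_nonneg fun l _ => hA.letterLaw_nonneg _ _
  calc _ = ∑ z, ((∏ l, A.letterLaw l (v l)) * W (A.inputMap v) z) *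
        ∑ a, A.letterLaw k a * A.chanScore u k (Function.update v k a) (z u) := by
        rw [Finset.sum_comm]
        refine Finset.sum_congr rfl fun z _ => ?_
        rw [Finset.mul_sum]
        refine Finset.sum_congr rfl fun a _ => ?_
        simp only [Fintype.prod_option, e, Option.elim, Equiv.piOptionEquivProd,
          Equiv.coe_fn_symm_mk]
        ring
    _ ≤ ∑ z, ((∏ l, A.letterLaw l (v l)) * W (A.inputMap v) z) * 1 := by
        refine Finset.sum_le_sum fun z _ => mul_le_mul_of_nonneg_left
          (hA.chan_sum u hu k hk v (z u)) (mul_nonneg h2 ((hW _).1 _))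
    _ = ∏ l, A.letterLaw l (v l) := by
        simp only [mul_one]
        rw [← Finset.mul_sum, (hW _).2, mul_one]

end Average

end Scheme

namespace Scheme

variable {K : ℕ} {S : Fin (K + 2) → Type*} {X Y : Fin (K + 1) → Type*} {N : ℕ} {V : Type*}
  {A : Scheme S X Y N V}

theorem level_le {u : Fin (K + 1)} (hu : A.Active u) : A.level u.succ ≤ N := by
  rcases hu with rfl | h
  · exact A.level_last.le
  · exact h.le

variable [Fintype V]

/-- The codebook is drawn afresh at every time, so averages factor over time even if the same
message is sent in several channel blocks. -/
theorem sum_bookLaw_mul {M Z : Type*} [Fintype M] [DecidableEq M] [Fintype Z] {T : ℕ}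
    (A : Scheme S X Y N V) (H : Fin T → (Fin (N + 1) × M → V) → Z → ℝ) :
    ∑ C : Fin T → Fin (N + 1) × M → V, ∑ y : Fin T → Z, A.bookLaw C * ∏ t, H t (C t) (y t) =
      ∏ t, ∑ c, ∑ z, (∏ i, A.letterLaw i.1 (c i)) * H t c z := by
  rw [← sum_sum_prod]
  unfold bookLaw
  simp only [Finset.prod_mul_distrib]

variable [∀ i, Fintype (S i)] [∀ v, Fintype (Y v)] {pS : (∀ i, S i) → ℝ}
  {W : (∀ j, X j) → (∀ v, Y v) → ℝ} {r : ℝ}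

theorem Valid.letterOutputLaw_nonneg (hA : A.Valid pS W r)
    (hW : ∀ x, W x ∈ stdSimplex ℝ (∀ v, Y v)) (p : (Fin (N + 1) → V) × (∀ v, Y v)) :
    0 ≤ A.letterOutputLaw W p :=
  mul_nonneg (Finset.prod_nonneg fun _ _ => hA.letterLaw_nonneg _ _) ((hW _).1 _)

theorem Valid.sum_letterOutputLaw (hA : A.Valid pS W r)
    (hW : ∀ x, W x ∈ stdSimplex ℝ (∀ v, Y v)) : ∑ p, A.letterOutputLaw W p = 1 := by
  rw [Fintype.sum_prod_type]
  unfold letterOutputLaw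
  simp only [← Finset.mul_sum, (hW _).2, mul_one]
  exact sum_prod_eq_one _ hA.letterLaw_sum

variable {B m n : ℕ}

theorem Valid.score_nonneg (hA : A.Valid pS W r)
    (C : Fin ((B + N) * n) → Fin (N + 1) × (Fin m → S 0) → V) (d : ∀ i, S i) (u : Fin (K + 1))
    (σ : ℕ → Fin m → S u.succ) (y : Fin ((B + N) * n) → Y u) (b : ℕ) (w : ℕ → Fin m → S 0)
    (c : Fin m → S 0) : 0 ≤ A.score C d u σ y b w c := by
  refine mul_nonneg (Finset.prod_nonneg fun _ _ => hA.side_nonneg _ _ _)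
    (Finset.prod_nonneg fun t _ => ?_)
  split_ifs
  · exact hA.chan_nonneg _ _ _ _
  · exact zero_le_one

variable [DecidableEq (S 0)]

/-- The average of a negative moment of the score of the true block. -/
theorem Valid.sum_score_true (hA : A.Valid pS W r) (hW : ∀ x, W x ∈ stdSimplex ℝ (∀ v, Y v))
    {u : Fin (K + 1)} (hu : A.Active u) (d : ∀ i, S i) (σ : ℕ → Fin m → S u.succ) {b : ℕ}
    (hb : b < B) (w : ℕ → Fin m → S 0) (lam : ℝ) :
    ∑ C : Fin ((B + N) * n) → Fin (N + 1) × (Fin m → S 0) → V,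
      ∑ y : Fin ((B + N) * n) → ∀ v, Y v, A.bookLaw C *
        ((∏ t, W (A.inputMap (word n C (fun _ => d 0) w t)) (y t)) *
          A.score C d u σ (fun t => y t u) b w (w b) ^ (-lam)) =
      (∏ j, A.sideScore u (w b j) (σ b j) ^ (-lam)) *
        (∏ k ∈ Finset.range (A.level u.succ), negMoment (A.letterOutputLaw W)
          (fun p => A.chanScore u k p.1 (p.2 u)) lam) ^ n := by
  -- The `N` additional channel blocks make room for the windows of the last source blocks.
  have hL : b + A.level u.succ ≤ B + N := by have := level_le hu; omega
  rw [← prod_window hL]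
  let f : Fin ((B + N) * n) → Fin (N + 1) → Fin m → S 0 :=
    fun t l => levelMsg N (fun _ => d 0) w (t.1 / n) l
  let G : Fin ((B + N) * n) → (Fin (N + 1) → V) → (∀ v, Y v) → ℝ := fun t v z =>
    if b ≤ t.1 / n ∧ t.1 / n < b + A.level u.succ then
      A.chanScore u (t.1 / n - b) v (z u) ^ (-lam) else 1
  have h1 : ∀ (C : Fin ((B + N) * n) → Fin (N + 1) × (Fin m → S 0) → V)
      (y : Fin ((B + N) * n) → ∀ v, Y v),
      A.bookLaw C * ((∏ t, W (A.inputMap (word n C (fun _ => d 0) w t)) (y t)) *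
          A.score C d u σ (fun t => y t u) b w (w b) ^ (-lam)) =
      (∏ j, A.sideScore u (w b j) (σ b j) ^ (-lam)) * (A.bookLaw C * ∏ t,
        (W (A.inputMap fun l => C t (l, f t l)) (y t) * G t (fun l => C t (l, f t l)) (y t))) := by
    intro C y
    have h2 : A.score C d u σ (fun t => y t u) b w (w b) ^ (-lam) =
        (∏ j, A.sideScore u (w b j) (σ b j) ^ (-lam)) *
          ∏ t, G t (fun l => C t (l, f t l)) (y t) := by
      unfold score
      rw [Real.mul_rpow (Finset.prod_nonneg fun _ _ => hA.side_nonneg _ _ _)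
        (Finset.prod_nonneg fun t _ => by
          split_ifs
          · exact hA.chan_nonneg _ _ _ _
          · exact zero_le_one),
        ← Real.finsetProd_rpow _ _ (fun _ _ => hA.side_nonneg _ _ _),
        ← Real.finsetProd_rpow _ _ (fun t _ => by
          split_ifs
          · exact hA.chan_nonneg _ _ _ _
          · exact zero_le_one)]
      congr 1
      refine Finset.prod_congr rfl fun t _ => ?_
      simp only [G, Function.update_eq_self]
      split_ifs
      · rfl
      · exact Real.one_rpow _
    rw [h2, Finset.prod_mul_distrib]
    change A.bookLaw C * ((∏ t, W (A.inputMap fun l => C t (l, f t l)) (y t)) * _) = _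
    ring
  have h3 := A.sum_bookLaw_mul (fun (t : Fin ((B + N) * n))
    (c : Fin (N + 1) × (Fin m → S 0) → V) (z : ∀ v, Y v) =>
      W (A.inputMap fun l => c (l, f t l)) z * G t (fun l => c (l, f t l)) z)
  have h4 : ∑ C : Fin ((B + N) * n) → Fin (N + 1) × (Fin m → S 0) → V,
      ∑ y : Fin ((B + N) * n) → ∀ v, Y v, (∏ j, A.sideScore u (w b j) (σ b j) ^ (-lam)) *
        (A.bookLaw C * ∏ t, (W (A.inputMap fun l => C t (l, f t l)) (y t) *
          G t (fun l => C t (l, f t l)) (y t))) =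
      (∏ j, A.sideScore u (w b j) (σ b j) ^ (-lam)) * ∏ t, ∑ c : Fin (N + 1) × (Fin m → S 0) → V, ∑ z,
        (∏ i, A.letterLaw i.1 (c i)) * (W (A.inputMap fun l => c (l, f t l)) z *
          G t (fun l => c (l, f t l)) z) := by
    rw [← h3, Finset.mul_sum]
    refine Finset.sum_congr rfl fun C _ => ?_
    rw [Finset.mul_sum]
  rw [Finset.sum_congr rfl fun C _ => Finset.sum_congr rfl fun y _ => h1 C y, h4]
  congr 1
  refine Finset.prod_congr rfl fun t _ => ?_
  rw [hA.sum_letters (f t) (G t)]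
  simp only [G]
  split_ifs with h
  · rfl
  · simpa using hA.sum_letterOutputLaw hW

/-- The average score of a wrong block. -/
theorem Valid.sum_score_wrong (hA : A.Valid pS W r) (hW : ∀ x, W x ∈ stdSimplex ℝ (∀ v, Y v))
    {u : Fin (K + 1)} (hu : A.Active u) (d : ∀ i, S i) (σ : ℕ → Fin m → S u.succ) (b : ℕ)
    (w : ℕ → Fin m → S 0) (c₀ : Fin m → S 0) (hc : c₀ ≠ w b) :
    ∑ C : Fin ((B + N) * n) → Fin (N + 1) × (Fin m → S 0) → V,
      ∑ y : Fin ((B + N) * n) → ∀ v, Y v, A.bookLaw C *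
        ((∏ t, W (A.inputMap (word n C (fun _ => d 0) w t)) (y t)) *
          A.score C d u σ (fun t => y t u) b w c₀) ≤
      ∏ j, A.sideScore u (c₀ j) (σ b j) := by
  let f : Fin ((B + N) * n) → Fin (N + 1) → Fin m → S 0 :=
    fun t l => levelMsg N (fun _ => d 0) w (t.1 / n) l
  -- The level that carries source block `b` at time `t`. Inside the window the reduction modulo `N
  -- + 1` changes nothing; outside it the value is irrelevant.
  let κ : Fin ((B + N) * n) → Fin (N + 1) := fun t => Fin.ofNat (N + 1) (t.1 / n - b)
  have hN := level_le hu
  have hκ : ∀ t : Fin ((B + N) * n), b ≤ t.1 / n ∧ t.1 / n < b + A.level u.succ →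
      (κ t).1 = t.1 / n - b := by
    intro t ht
    exact Nat.mod_eq_of_lt (by omega)
  let G : Fin ((B + N) * n) → (Fin (N + 1) × (Fin m → S 0) → V) → (∀ v, Y v) → ℝ := fun t c z =>
    if b ≤ t.1 / n ∧ t.1 / n < b + A.level u.succ then
      A.chanScore u (κ t) (Function.update (fun l => c (l, f t l)) (κ t) (c (κ t, c₀))) (z u) else 1
  have h1 : ∀ (C : Fin ((B + N) * n) → Fin (N + 1) × (Fin m → S 0) → V)
      (y : Fin ((B + N) * n) → ∀ v, Y v),
      A.bookLaw C * ((∏ t, W (A.inputMap (word n C (fun _ => d 0) w t)) (y t)) *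
          A.score C d u σ (fun t => y t u) b w c₀) =
      (∏ j, A.sideScore u (c₀ j) (σ b j)) * (A.bookLaw C * ∏ t,
        (W (A.inputMap fun l => C t (l, f t l)) (y t) * G t (C t) (y t))) := by
    intro C y
    have h2 : A.score C d u σ (fun t => y t u) b w c₀ =
        (∏ j, A.sideScore u (c₀ j) (σ b j)) * ∏ t, G t (C t) (y t) := by
      unfold score
      congr 1
      refine Finset.prod_congr rfl fun t _ => ?_
      simp only [G]
      split_ifs with ht
      · rw [hκ t ht]
        apply A.chanScore_congr
        intro l hl
        by_cases e : l = κ t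
        · subst e
          have h3 : (κ t).1 < N ∧ (κ t).1 ≤ t.1 / n := by rw [hκ t ht]; omega
          have h4 : t.1 / n - (κ t).1 = b := by rw [hκ t ht]; omega
          simp only [word, levelMsg, if_pos h3, h4, Function.update_self]
        · have h5 : l.1 ≠ t.1 / n - b := by
            intro h
            exact e (Fin.ext (by rw [hκ t ht, h]))
          rw [Function.update_of_ne e]
          simp only [word, levelMsg, f]
          split_ifs with h6
          · rw [Function.update_of_ne (by omega)]
          · rfl
      · rfl
    rw [h2, Finset.prod_mul_distrib]
    change A.bookLaw C * ((∏ t, W (A.inputMap fun l => C t (l, f t l)) (y t)) * _) = _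
    ring
  have h3 := A.sum_bookLaw_mul (fun (t : Fin ((B + N) * n))
    (c : Fin (N + 1) × (Fin m → S 0) → V) (z : ∀ v, Y v) =>
      W (A.inputMap fun l => c (l, f t l)) z * G t c z)
  have h4 : ∑ C : Fin ((B + N) * n) → Fin (N + 1) × (Fin m → S 0) → V,
      ∑ y : Fin ((B + N) * n) → ∀ v, Y v, (∏ j, A.sideScore u (c₀ j) (σ b j)) * (A.bookLaw C * ∏ t,
        (W (A.inputMap fun l => C t (l, f t l)) (y t) * G t (C t) (y t))) =
      (∏ j, A.sideScore u (c₀ j) (σ b j)) * ∏ t, ∑ c, ∑ z, (∏ i, A.letterLaw i.1 (c i)) *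
        (W (A.inputMap fun l => c (l, f t l)) z * G t c z) := by
    rw [← h3, Finset.mul_sum]
    refine Finset.sum_congr rfl fun C _ => ?_
    rw [Finset.mul_sum]
  rw [Finset.sum_congr rfl fun C _ => Finset.sum_congr rfl fun y _ => h1 C y, h4]
  refine mul_le_of_le_one_right (Finset.prod_nonneg fun _ _ => hA.side_nonneg _ _ _) ?_
  refine Finset.prod_le_one (fun t _ => ?_) (fun t _ => ?_)
  · refine Finset.sum_nonneg fun c _ => Finset.sum_nonneg fun z _ => mul_nonneg
      (Finset.prod_nonneg fun _ _ => hA.letterLaw_nonneg _ _) (mul_nonneg ((hW _).1 _) ?_)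
    simp only [G]
    split_ifs
    · exact hA.chan_nonneg _ _ _ _
    · exact zero_le_one
  · simp only [G]
    split_ifs with ht
    · have h6 : (κ t).1 < N ∧ (κ t).1 ≤ t.1 / n := by rw [hκ t ht]; omega
      have h7 : t.1 / n - (κ t).1 = b := by rw [hκ t ht]; omega
      refine hA.sum_letters_extra hW hu (f t) (κ t) (by rw [hκ t ht]; omega) c₀ ?_
      simp only [f, levelMsg, if_pos h6, h7]
      exact hc.symm
    · have := hA.sum_letters (f t) (fun _ _ => 1)
      rw [this]
      simpa using (hA.sum_letterOutputLaw hW).le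

end Scheme

theorem sum_sum_comm {α β γ δ : Type*} (s : Finset α) (t : Finset β) (u : Finset γ) (v : Finset δ)
    (f : α → β → γ → δ → ℝ) :
    ∑ a ∈ s, ∑ b ∈ t, ∑ c ∈ u, ∑ d ∈ v, f a b c d =
      ∑ c ∈ u, ∑ d ∈ v, ∑ a ∈ s, ∑ b ∈ t, f a b c d := by
  calc _ = ∑ p ∈ s ×ˢ t, ∑ q ∈ u ×ˢ v, f p.1 p.2 q.1 q.2 := by simp only [Finset.sum_product]
    _ = ∑ q ∈ u ×ˢ v, ∑ p ∈ s ×ˢ t, f p.1 p.2 q.1 q.2 := Finset.sum_comm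
    _ = _ := by simp only [Finset.sum_product]

/-! ### Error bound for a random codebook -/

namespace Scheme

variable {K : ℕ} {S : Fin (K + 2) → Type*} {X Y : Fin (K + 1) → Type*} {N : ℕ} {V : Type*}
  {A : Scheme S X Y N V} [Fintype V] [∀ i, Fintype (S i)] [∀ v, Fintype (Y v)]
  {pS : (∀ i, S i) → ℝ} {W : (∀ j, X j) → (∀ v, Y v) → ℝ} {r : ℝ} {B m n : ℕ}

/-- A bound on the indicator of a decoding error of the receiver `u` in the block `b`. -/
noncomputable def badTerm [DecidableEq (S 0)] (A : Scheme S X Y N V)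
    (C : Fin ((B + N) * n) → Fin (N + 1) × (Fin m → S 0) → V) (d : ∀ i, S i)
    (u : Fin (K + 1)) (θ lam : ℝ) (b : ℕ) (s : Fin (B * m) → ∀ i, S i)
    (y : Fin ((B + N) * n) → ∀ v, Y v) : ℝ :=
  θ ^ lam * A.score C d u (block (d u.succ) fun l => s l u.succ) (fun t => y t u) b
      (block (d 0) fun l => s l 0) (block (d 0) (fun l => s l 0) b) ^ (-lam) +
    ∑ c : Fin m → S 0, if c = block (d 0) (fun l => s l 0) b then 0 else
      A.score C d u (block (d u.succ) fun l => s l u.succ) (fun t => y t u) b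
        (block (d 0) fun l => s l 0) c / θ

variable [DecidableEq (S 0)]

theorem Valid.badTerm_nonneg (hA : A.Valid pS W r)
    (C : Fin ((B + N) * n) → Fin (N + 1) × (Fin m → S 0) → V) (d : ∀ i, S i)
    (u : Fin (K + 1)) {θ : ℝ} (hθ : 0 < θ) (lam : ℝ) (b : ℕ) (s : Fin (B * m) → ∀ i, S i)
    (y : Fin ((B + N) * n) → ∀ v, Y v) : 0 ≤ A.badTerm C d u θ lam b s y := by
  refine add_nonneg (mul_nonneg (Real.rpow_nonneg hθ.le _)
    (Real.rpow_nonneg (hA.score_nonneg _ _ _ _ _ _ _ _) _)) (Finset.sum_nonneg fun c _ => ?_)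
  split_ifs
  · exact le_rfl
  · exact div_nonneg (hA.score_nonneg _ _ _ _ _ _ _ _) hθ.le

/-- For a fixed source sequence, the codebook average of the first term is `sum_score_true`, and
that of the second is at most the sum of the side scores of the wrong blocks over `θ`, by
`sum_score_wrong`. Averaging over the source gives the moment of the side score, and `side_sum`
gives `1 / θ`. -/
theorem Valid.sum_badTerm_le (hA : A.Valid pS W r) (hpS : pS ∈ stdSimplex ℝ (∀ i, S i))
    (hW : ∀ x, W x ∈ stdSimplex ℝ (∀ v, Y v)) (d : ∀ i, S i) {u : Fin (K + 1)} (hu : A.Active u)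
    {θ : ℝ} (hθ : 0 < θ) (lam : ℝ) {b : ℕ} (hb : b < B) :
    ∑ s : Fin (B * m) → ∀ i, S i,
      ∑ C : Fin ((B + N) * n) → Fin (N + 1) × (Fin m → S 0) → V,
      ∑ y : Fin ((B + N) * n) → ∀ v, Y v,
        A.bookLaw C * (A.idealProb pS W C d s y * A.badTerm C d u θ lam b s y) ≤
      θ ^ lam * (negMoment pS (fun s => A.sideScore u (s 0) (s u.succ)) lam ^ m *
        (∏ k ∈ Finset.range (A.level u.succ), negMoment (A.letterOutputLaw W)
          (fun p => A.chanScore u k p.1 (p.2 u)) lam) ^ n) + 1 / θ := by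
  set R := (∏ k ∈ Finset.range (A.level u.succ), negMoment (A.letterOutputLaw W)
          (fun p => A.chanScore u k p.1 (p.2 u)) lam) ^ n with hR
  let e : Fin m → Fin (B * m) := fun j => finProdFinEquiv (⟨b, hb⟩, j)
  have he : Function.Injective e := fun j j' h => (Prod.mk.inj (finProdFinEquiv.injective h)).2
  have hblk : ∀ (i : Fin (K + 2)) (s : Fin (B * m) → ∀ i, S i),
      block (d i) (fun l => s l i) b = fun j => s (e j) i := by
    intro i s
    funext j
    simp [block, hb, e]
  have hs1 : ∑ s : Fin (B * m) → ∀ i, S i, ∏ l, pS (s l) = 1 :=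
    sum_prod_eq_one (fun _ => pS) (fun _ => hpS.2)
  have hside : ∑ s : Fin (B * m) → ∀ i, S i, (∏ l, pS (s l)) *
      ∏ j, A.sideScore u (s (e j) 0) (s (e j) u.succ) ^ (-lam) =
      negMoment pS (fun s => A.sideScore u (s 0) (s u.succ)) lam ^ m := by
    have := sum_prod_mul_comp (fun _ : Fin (B * m) => pS) (fun _ => hpS.2) e he
      (fun s => ∏ j, A.sideScore u (s j 0) (s j u.succ) ^ (-lam))
    refine this.trans ?_
    simp only [← Finset.prod_mul_distrib]
    rw [← Fintype.prod_sum (fun (_ : Fin m) (s : ∀ i, S i) =>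
      pS s * A.sideScore u (s 0) (s u.succ) ^ (-lam))]
    simp [negMoment]
  have key : ∀ s : Fin (B * m) → ∀ i, S i,
      ∑ C : Fin ((B + N) * n) → Fin (N + 1) × (Fin m → S 0) → V,
      ∑ y : Fin ((B + N) * n) → ∀ v, Y v,
        A.bookLaw C * (A.idealProb pS W C d s y * A.badTerm C d u θ lam b s y) ≤
      θ ^ lam * ((∏ l, pS (s l)) *
        ∏ j, A.sideScore u (s (e j) 0) (s (e j) u.succ) ^ (-lam)) * R +
        (∏ l, pS (s l)) * (1 / θ) := by
    intro s
    set σ := block (m := m) (d u.succ) (fun l => s l u.succ) with hσ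
    set w := block (m := m) (d 0) (fun l => s l 0) with hw
    have h1 := hA.sum_score_true (n := n) hW hu d σ hb w lam
    have h2 := fun c (hc : c ≠ w b) => hA.sum_score_wrong (B := B) (n := n) hW hu d σ b w c hc
    have hp : 0 ≤ ∏ l, pS (s l) := Finset.prod_nonneg fun l _ => hpS.1 _
    have expand : ∀ (C : Fin ((B + N) * n) → Fin (N + 1) × (Fin m → S 0) → V)
        (y : Fin ((B + N) * n) → ∀ v, Y v),
        A.bookLaw C * (A.idealProb pS W C d s y * A.badTerm C d u θ lam b s y) =
        θ ^ lam * (∏ l, pS (s l)) * (A.bookLaw C *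
          ((∏ t, W (A.inputMap (word n C (fun _ => d 0) w t)) (y t)) *
            A.score C d u σ (fun t => y t u) b w (w b) ^ (-lam))) +
        ∑ c : Fin m → S 0, (if c = w b then 0 else (∏ l, pS (s l)) * (1 / θ) * (A.bookLaw C *
          ((∏ t, W (A.inputMap (word n C (fun _ => d 0) w t)) (y t)) *
            A.score C d u σ (fun t => y t u) b w c))) := by
      intro C y
      change A.bookLaw C * (((∏ l, pS (s l)) *
        ∏ t, W (A.inputMap (word n C (fun _ => d 0) w t)) (y t)) *
        (θ ^ lam * A.score C d u σ (fun t => y t u) b w (w b) ^ (-lam) +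
          ∑ c : Fin m → S 0, if c = w b then 0 else
            A.score C d u σ (fun t => y t u) b w c / θ)) = _
      rw [mul_add, mul_add, Finset.mul_sum, Finset.mul_sum]
      congr 1
      · ring
      · refine Finset.sum_congr rfl fun c _ => ?_
        split_ifs
        · simp
        · ring
    rw [Finset.sum_congr rfl fun C _ => Finset.sum_congr rfl fun y _ => expand C y]
    simp only [Finset.sum_add_distrib]
    refine add_le_add (le_of_eq ?_) ?_
    · simp only [← Finset.mul_sum]
      simp only [← Finset.mul_sum] at h1
      rw [h1]
      simp only [hσ, hw, hblk]
      ring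
    · have swap : ∀ F : (Fin ((B + N) * n) → Fin (N + 1) × (Fin m → S 0) → V) →
          (Fin ((B + N) * n) → ∀ v, Y v) → (Fin m → S 0) → ℝ,
          ∑ C, ∑ y, ∑ c, F C y c = ∑ c, ∑ C, ∑ y, F C y c := by
        intro F
        rw [Finset.sum_comm]
        conv_rhs => rw [Finset.sum_comm]
        rw [Finset.sum_comm]
        refine Finset.sum_congr rfl fun C _ => ?_
        rw [Finset.sum_comm]
      rw [swap]
      by_cases hpos : ∀ l, 0 < pS (s l)
      · have h3 := hA.side_sum u hu m (fun j => s (e j)) (fun j => hpos _)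
        calc _ ≤ ∑ c : Fin m → S 0, (∏ l, pS (s l)) * (1 / θ) *
              (open Classical in if c = fun l => s (e l) 0 then 0 else
                ∏ l, A.sideScore u (c l) (s (e l) u.succ)) := by
              refine Finset.sum_le_sum fun c _ => ?_
              have hwb : w b = fun l => s (e l) 0 := hblk 0 s
              by_cases hc : c = w b
              · simp [hc, hwb]
              · rw [if_neg (by rw [← hwb]; exact hc)]
                simp only [if_neg hc, ← Finset.mul_sum]
                refine mul_le_mul_of_nonneg_left ?_ (by positivity)
                have h4 := h2 c hc
                simp only [← Finset.mul_sum] at h4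
                refine h4.trans (le_of_eq ?_)
                rw [hσ, hblk]
          _ ≤ _ := by
              rw [← Finset.mul_sum]
              exact mul_le_of_le_one_right (by positivity)
                ((Finset.sum_congr rfl fun c _ => by congr).trans_le h3)
      · have h5 : ∏ l, pS (s l) = 0 := by
          push Not at hpos
          obtain ⟨l, hl⟩ := hpos
          exact Finset.prod_eq_zero (Finset.mem_univ l) (le_antisymm hl (hpS.1 _))
        simp [h5]
  refine (Finset.sum_le_sum fun s _ => key s).trans (le_of_eq ?_)
  rw [Finset.sum_add_distrib, ← Finset.sum_mul, ← Finset.sum_mul, ← Finset.mul_sum, hside, hs1]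
  ring

/-- A receiver that errs contributes at least one to the error bound, on the support. -/
theorem Valid.one_le_sum_badTerm (hA : A.Valid pS W r) (hpS : pS ∈ stdSimplex ℝ (∀ i, S i))
    (hW : ∀ x, W x ∈ stdSimplex ℝ (∀ v, Y v))
    (C : Fin ((B + N) * n) → Fin (N + 1) × (Fin m → S 0) → V) (d : ∀ i, S i)
    (θ lam : Fin (K + 1) → ℝ) (hθ : ∀ u, 0 < θ u) (hlam : ∀ u, 0 < lam u)
    (U : Finset (Fin (K + 1))) (hU : ∀ u, A.Active u → u ∈ U)
    (s : Fin (B * m) → ∀ i, S i) (y : Fin ((B + N) * n) → ∀ v, Y v)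
    (hC : A.bookLaw C ≠ 0) (hi : A.idealProb pS W C d s y ≠ 0) (hg : ¬ A.Good C d θ s y) :
    1 ≤ ∑ u ∈ U, ∑ b ∈ Finset.range B, A.badTerm C d u (θ u) (lam u) b s y := by
  unfold Good at hg
  push Not at hg
  obtain ⟨u, hu, b, hb, c, hc⟩ := hg
  have hle : A.badTerm C d u (θ u) (lam u) b s y ≤
      ∑ u ∈ U, ∑ b ∈ Finset.range B, A.badTerm C d u (θ u) (lam u) b s y := by
    refine le_trans (Finset.single_le_sum
      (f := fun b => A.badTerm C d u (θ u) (lam u) b s y)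
      (fun b _ => hA.badTerm_nonneg C d u (hθ u) (lam u) b s y) (Finset.mem_range.2 hb)) ?_
    exact Finset.single_le_sum
      (f := fun u => ∑ b ∈ Finset.range B, A.badTerm C d u (θ u) (lam u) b s y)
      (fun u _ => Finset.sum_nonneg fun b _ => hA.badTerm_nonneg C d u (hθ u) (lam u) b s y)
      (hU u hu)
  refine le_trans ?_ hle
  unfold badTerm
  set σ := block (m := m) (d u.succ) (fun l => s l u.succ) with hσ
  set w := block (m := m) (d 0) (fun l => s l 0) with hw
  have hnn : ∀ c, 0 ≤ if c = w b then 0 else A.score C d u σ (fun t => y t u) b w c / θ u := by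
    intro c
    split_ifs
    · exact le_rfl
    · exact div_nonneg (hA.score_nonneg _ _ _ _ _ _ _ _) (hθ u).le
  rcases hc with ⟨h1, h2⟩ | ⟨h1, h2⟩
  · have h3 : 1 ≤ A.score C d u σ (fun t => y t u) b w c / θ u := by
      rw [le_div_iff₀ (hθ u), one_mul]
      exact h1
    have h4 := Finset.single_le_sum (f := fun c => if c = w b then 0 else
      A.score C d u σ (fun t => y t u) b w c / θ u) (fun c _ => hnn c) (Finset.mem_univ c)
    simp only [if_neg h2] at h4
    have h5 : 0 ≤ θ u ^ lam u * A.score C d u σ (fun t => y t u) b w (w b) ^ (-lam u) :=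
      mul_nonneg (Real.rpow_nonneg (hθ u).le _)
        (Real.rpow_nonneg (hA.score_nonneg _ _ _ _ _ _ _ _) _)
    linarith
  · subst h2
    have hlt : A.score C d u σ (fun t => y t u) b w (w b) < θ u := not_le.1 h1
    -- Positivity is essential: `0 ^ (-lam u)` is `0` by convention, so the bound would miss a
    -- rejected true block of score zero.
    have hpos : 0 < A.score C d u σ (fun t => y t u) b w (w b) := by
      unfold idealProb at hi
      have hi1 := left_ne_zero_of_mul hi
      have hi2 := right_ne_zero_of_mul hi
      refine mul_pos (Finset.prod_pos fun j _ => ?_) (Finset.prod_pos fun t _ => ?_)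
      · have := Finset.prod_ne_zero_iff.1 hi1 (finProdFinEquiv (⟨b, hb⟩, j)) (Finset.mem_univ _)
        have := hA.side_pos u hu _ (lt_of_le_of_ne (hpS.1 _) this.symm)
        simpa [hσ, hw, block, hb] using this
      · split_ifs with ht
        · rw [Function.update_eq_self]
          refine hA.chan_pos u hu _ (by omega) (word n C (fun _ => d 0) w t, y t) ?_
          refine mul_pos (Finset.prod_pos fun l _ => ?_) ?_
          · have h1 := Finset.prod_ne_zero_iff.1 hC t (Finset.mem_univ _)
            have h2 := Finset.prod_ne_zero_iff.1 h1
              (l, levelMsg N (fun _ => d 0) w (t.1 / n) l) (Finset.mem_univ _)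
            exact lt_of_le_of_ne (hA.letterLaw_nonneg _ _) h2.symm
          · exact lt_of_le_of_ne ((hW _).1 _)
              (Finset.prod_ne_zero_iff.1 hi2 t (Finset.mem_univ _)).symm
        · exact zero_lt_one
    have h6 : 1 ≤ θ u ^ lam u * A.score C d u σ (fun t => y t u) b w (w b) ^ (-lam u) := by
      rw [Real.rpow_neg hpos.le, ← div_eq_mul_inv, ← Real.div_rpow (hθ u).le hpos.le]
      refine Real.one_le_rpow ?_ (hlam u).le
      rw [le_div_iff₀ hpos, one_mul]
      exact hlt.le
    have h7 := Finset.sum_nonneg fun c (_ : c ∈ Finset.univ) => hnn c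
    linarith

open Classical in
/-- Random coding: some codebook is as good as the average. -/
theorem Valid.exists_code (hA : A.Valid pS W r) (hpS : pS ∈ stdSimplex ℝ (∀ i, S i))
    (hW : ∀ x, W x ∈ stdSimplex ℝ (∀ v, Y v)) (d : ∀ i, S i) (y₀ : ∀ u, Y u)
    (θ lam : Fin (K + 1) → ℝ) (hθ : ∀ u, 0 < θ u) (hlam : ∀ u, 0 < lam u) (B m n : ℕ) :
    ∃ c : Code S X Y (B * m) ((B + N) * n), c.errorProb pS W ≤
      ∑ u with A.Active u, B * (θ u ^ lam u *
        (negMoment pS (fun s => A.sideScore u (s 0) (s u.succ)) (lam u) ^ m *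
        (∏ k ∈ Finset.range (A.level u.succ), negMoment (A.letterOutputLaw W)
          (fun p => A.chanScore u k p.1 (p.2 u)) (lam u)) ^ n) + 1 / θ u) := by
  set U : Finset (Fin (K + 1)) := Finset.univ.filter A.Active with hU
  have hU' : ∀ u, A.Active u → u ∈ U := fun u hu => by simp [hU, hu]
  have hE : ∑ C : Fin ((B + N) * n) → Fin (N + 1) × (Fin m → S 0) → V,
      A.bookLaw C * (A.code C d θ y₀).errorProb pS W ≤ ∑ u ∈ U, B * (θ u ^ lam u *
        (negMoment pS (fun s => A.sideScore u (s 0) (s u.succ)) (lam u) ^ m *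
        (∏ k ∈ Finset.range (A.level u.succ), negMoment (A.letterOutputLaw W)
          (fun p => A.chanScore u k p.1 (p.2 u)) (lam u)) ^ n) + 1 / θ u) := by
    have hid : ∀ (C : Fin ((B + N) * n) → Fin (N + 1) × (Fin m → S 0) → V) s y,
        0 ≤ A.idealProb pS W C d s y := fun C s y =>
      mul_nonneg (Finset.prod_nonneg fun l _ => hpS.1 _) (Finset.prod_nonneg fun t _ => (hW _).1 _)
    have hbad : ∀ (C : Fin ((B + N) * n) → Fin (N + 1) × (Fin m → S 0) → V) s y,
        0 ≤ ∑ u ∈ U, ∑ b ∈ Finset.range B, A.badTerm C d u (θ u) (lam u) b s y := fun C s y =>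
      Finset.sum_nonneg fun u _ => Finset.sum_nonneg fun b _ =>
        hA.badTerm_nonneg C d u (hθ u) (lam u) b s y
    calc _ ≤ ∑ C : Fin ((B + N) * n) → Fin (N + 1) × (Fin m → S 0) → V, A.bookLaw C *
          ∑ s, ∑ y, A.idealProb pS W C d s y *
            ∑ u ∈ U, ∑ b ∈ Finset.range B, A.badTerm C d u (θ u) (lam u) b s y := by
          refine Finset.sum_le_sum fun C _ => ?_
          by_cases h0 : A.bookLaw C = 0
          · simp [h0]
          · refine mul_le_mul_of_nonneg_left ?_ (hA.bookLaw_nonneg C)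
            refine errorProb_le hpS hW C d θ y₀ _
              (fun s y => mul_nonneg (hid C s y) (hbad C s y)) fun s y hg => ?_
            by_cases h1 : A.idealProb pS W C d s y = 0
            · simp [h1]
            · exact le_mul_of_one_le_right (hid C s y)
                (hA.one_le_sum_badTerm hpS hW C d θ lam hθ hlam U hU' s y h0 h1 hg)
      _ = ∑ u ∈ U, ∑ b ∈ Finset.range B, ∑ s : Fin (B * m) → ∀ i, S i,
          ∑ C : Fin ((B + N) * n) → Fin (N + 1) × (Fin m → S 0) → V,
          ∑ y : Fin ((B + N) * n) → ∀ v, Y v,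
            A.bookLaw C * (A.idealProb pS W C d s y * A.badTerm C d u (θ u) (lam u) b s y) := by
          simp only [Finset.mul_sum]
          rw [Finset.sum_comm]
          have : ∀ (s : Fin (B * m) → ∀ i, S i),
              ∑ C : Fin ((B + N) * n) → Fin (N + 1) × (Fin m → S 0) → V,
              ∑ y : Fin ((B + N) * n) → ∀ v, Y v, ∑ u ∈ U, ∑ b ∈ Finset.range B,
                A.bookLaw C * (A.idealProb pS W C d s y * A.badTerm C d u (θ u) (lam u) b s y) =
              ∑ u ∈ U, ∑ b ∈ Finset.range B,
              ∑ C : Fin ((B + N) * n) → Fin (N + 1) × (Fin m → S 0) → V,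
              ∑ y : Fin ((B + N) * n) → ∀ v, Y v,
                A.bookLaw C * (A.idealProb pS W C d s y * A.badTerm C d u (θ u) (lam u) b s y) := by
            intro s
            exact sum_sum_comm _ _ _ _ _
          simp only [this]
          rw [Finset.sum_comm]
          refine Finset.sum_congr rfl fun u _ => ?_
          rw [Finset.sum_comm]
      _ ≤ ∑ u ∈ U, ∑ b ∈ Finset.range B, (θ u ^ lam u *
        (negMoment pS (fun s => A.sideScore u (s 0) (s u.succ)) (lam u) ^ m *
        (∏ k ∈ Finset.range (A.level u.succ), negMoment (A.letterOutputLaw W)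
          (fun p => A.chanScore u k p.1 (p.2 u)) (lam u)) ^ n) + 1 / θ u) := by
          refine Finset.sum_le_sum fun u hu => Finset.sum_le_sum fun b hb => ?_
          exact hA.sum_badTerm_le hpS hW d (by simpa [hU] using hu) (hθ u) (lam u)
            (Finset.mem_range.1 hb)
      _ = _ := by
          simp only [Finset.sum_const, Finset.card_range, nsmul_eq_mul]
  obtain ⟨C, hC⟩ := exists_le_of_sum_mul_le _ _ (fun C => hA.bookLaw_nonneg C) hA.sum_bookLaw hE
  exact ⟨_, hC⟩

end Scheme

/-! ### Exponents, thresholds and rates -/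

namespace Scheme

variable {K : ℕ} {S : Fin (K + 2) → Type*} {X Y : Fin (K + 1) → Type*} {N : ℕ} {V : Type*}
  {A : Scheme S X Y N V} [Fintype V] [∀ i, Fintype (S i)] [∀ v, Fintype (Y v)]
  {pS : (∀ i, S i) → ℝ} {W : (∀ j, X j) → (∀ v, Y v) → ℝ} {r : ℝ}

/-- The source length `m` is `r * n` up to a rounding error of at most one, which costs the constant
factor `exp |log a|`; all else is exponential in `n`. -/
theorem exp_mul_pow_mul_prod_le {ι : Type*} (I : Finset ι) {a : ℝ} (ha : 0 < a) {R : ι → ℝ}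
    (hR : ∀ k ∈ I, 0 < R k) (r δ lam : ℝ) (m n : ℕ) (hm1 : r * n ≤ m) (hm2 : m ≤ r * n + 1) :
    Real.exp (δ * n) ^ lam * (a ^ m * (∏ k ∈ I, R k) ^ n) ≤
      Real.exp |Real.log a| *
        Real.exp (lam * δ + (r * Real.log a + ∑ k ∈ I, Real.log (R k))) ^ n := by
  have h1 : a ^ m = Real.exp (m * Real.log a) := by
    rw [Real.exp_nat_mul, Real.exp_log ha]
  have h2 : (∏ k ∈ I, R k) ^ n = Real.exp (n * ∑ k ∈ I, Real.log (R k)) := by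
    rw [Real.exp_nat_mul, Real.exp_sum, Finset.prod_congr rfl fun k hk => Real.exp_log (hR k hk)]
  rw [h1, h2, ← Real.exp_mul, ← Real.exp_add, ← Real.exp_add, ← Real.exp_nat_mul, ← Real.exp_add,
    Real.exp_le_exp]
  have h3 : (m - r * n) * Real.log a ≤ |Real.log a| := by
    calc (m - r * n) * Real.log a ≤ (m - r * n) * |Real.log a| :=
          mul_le_mul_of_nonneg_left (le_abs_self _) (by linarith)
      _ ≤ 1 * |Real.log a| := mul_le_mul_of_nonneg_right (by linarith) (abs_nonneg _)
      _ = _ := one_mul _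
  linarith

theorem Valid.exists_exponents (hA : A.Valid pS W r) (hpS : pS ∈ stdSimplex ℝ (∀ i, S i))
    (hW : ∀ x, W x ∈ stdSimplex ℝ (∀ v, Y v)) (u : Fin (K + 1)) :
    ∃ lam δ : ℝ, 0 < lam ∧ 0 < δ ∧ (A.Active u → lam * δ +
      (r * Real.log (negMoment pS (fun s => A.sideScore u (s 0) (s u.succ)) lam) +
      ∑ k ∈ Finset.range (A.level u.succ), Real.log (negMoment (A.letterOutputLaw W)
        (fun p => A.chanScore u k p.1 (p.2 u)) lam)) < 0) := by
  by_cases hu : A.Active u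
  · obtain ⟨lam, h0, hneg⟩ := exists_negMoment_decay r pS
      (fun s => A.sideScore u (s 0) (s u.succ)) hpS.1 hpS.2 (hA.side_pos u hu)
      (A.level u.succ) (A.letterOutputLaw W) (fun k p => A.chanScore u k p.1 (p.2 u))
      (hA.letterOutputLaw_nonneg hW) (hA.sum_letterOutputLaw hW) (hA.chan_pos u hu)
      (hA.drift u hu)
    set g := r * Real.log (negMoment pS (fun s => A.sideScore u (s 0) (s u.succ)) lam) +
      ∑ k ∈ Finset.range (A.level u.succ), Real.log (negMoment (A.letterOutputLaw W)
        (fun p => A.chanScore u k p.1 (p.2 u)) lam)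
    -- The threshold exponent consumes half of the decay: `lam * δ = -g / 2`.
    refine ⟨lam, -g / (2 * lam), h0, div_pos (by linarith) (by linarith), fun _ => ?_⟩
    have : lam * (-g / (2 * lam)) = -g / 2 := by field_simp
    rw [this]
    linarith
  · exact ⟨1, 1, one_pos, one_pos, fun h => absurd h hu⟩

/-- A valid scheme for the rate `r` achieves every smaller rate. -/
theorem Valid.achievable (hA : A.Valid pS W r) (hr : 0 < r) {r' : ℝ} (hr' : r' < r)
    (hpS : pS ∈ stdSimplex ℝ (∀ i, S i)) (hW : ∀ x, W x ∈ stdSimplex ℝ (∀ v, Y v))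
    (d : ∀ i, S i) (y₀ : ∀ u, Y u) : Achievable pS W r' := by
  classical
  choose lam δ hlam hδ hexp using hA.exists_exponents hpS hW
  -- This choice gives `r' * (B + N) ≤ r * B`. As `B` stays fixed, the factor `B` from the union
  -- bound over blocks is harmless.
  obtain ⟨B₀, hB₀⟩ := exists_nat_ge (r' * N / (r - r'))
  set B := B₀ + 1 with hB
  have hBr : r' * N ≤ B * (r - r') := by
    have h1 : r' * N / (r - r') ≤ B := by rw [hB]; push_cast; linarith
    rwa [div_le_iff₀ (by linarith)] at h1
  let m' : ℕ → ℕ := fun q => ⌈r * ((q + 1 : ℕ) : ℝ)⌉₊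
  have hm1 : ∀ q, r * ((q + 1 : ℕ) : ℝ) ≤ m' q := fun q => Nat.le_ceil _
  have hm2 : ∀ q, (m' q : ℝ) ≤ r * ((q + 1 : ℕ) : ℝ) + 1 := fun q =>
    (Nat.ceil_lt_add_one (by positivity)).le
  choose c hc using fun q => hA.exists_code hpS hW d y₀
    (fun u => Real.exp (δ u * ((q + 1 : ℕ) : ℝ))) lam (fun u => Real.exp_pos _) hlam B (m' q) (q + 1)
  refine ⟨fun q => B * m' q, fun q => (B + N) * (q + 1), c, ?_, ?_, ?_, ?_⟩
  · intro q
    have hpos : 0 < (B + N) * (q + 1) := by positivity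
    refine ⟨hpos, ?_⟩
    rw [le_div_iff₀ (by exact_mod_cast hpos)]
    push_cast
    have h1 := hm1 q
    push_cast at h1
    have h2 : (B : ℝ) * (r * (q + 1)) ≤ B * m' q := mul_le_mul_of_nonneg_left h1 (by positivity)
    have h3 : r' * N * ((q : ℝ) + 1) ≤ B * (r - r') * (q + 1) :=
      mul_le_mul_of_nonneg_right hBr (by positivity)
    linarith
  · have h1 : Filter.Tendsto (fun q : ℕ => r * ((q + 1 : ℕ) : ℝ)) Filter.atTop Filter.atTop :=
      Filter.Tendsto.const_mul_atTop hr
        (tendsto_natCast_atTop_atTop.comp (Filter.tendsto_add_atTop_nat 1))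
    have h2 : Filter.Tendsto m' Filter.atTop Filter.atTop := tendsto_nat_ceil_atTop.comp h1
    exact Filter.tendsto_atTop_mono (fun q => Nat.le_mul_of_pos_left _ (by omega)) h2
  · exact Filter.tendsto_atTop_mono (fun q =>
      (Nat.le_succ q).trans (Nat.le_mul_of_pos_left _ (by omega))) Filter.tendsto_id
  · have hnn : ∀ q, 0 ≤ (c q).errorProb pS W := by
      intro q
      refine Finset.sum_nonneg fun s _ => Finset.sum_nonneg fun y _ => ?_
      split_ifs
      · exact mul_nonneg (Finset.prod_nonneg fun l _ => hpS.1 _)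
          (Finset.prod_nonneg fun t _ => (hW _).1 _)
      · exact le_rfl
    let E : ℕ → ℝ := fun n => ∑ u with A.Active u, (B : ℝ) * (
      Real.exp |Real.log (negMoment pS (fun s => A.sideScore u (s 0) (s u.succ)) (lam u))| *
        Real.exp (lam u * δ u +
          (r * Real.log (negMoment pS (fun s => A.sideScore u (s 0) (s u.succ)) (lam u)) +
          ∑ k ∈ Finset.range (A.level u.succ), Real.log (negMoment (A.letterOutputLaw W)
            (fun p => A.chanScore u k p.1 (p.2 u)) (lam u)))) ^ n + Real.exp (-δ u) ^ n)
    have hE : Filter.Tendsto E Filter.atTop (nhds 0) := by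
      have h1 : Filter.Tendsto E Filter.atTop (nhds (∑ u with A.Active u, (B : ℝ) * (
          Real.exp |Real.log (negMoment pS (fun s => A.sideScore u (s 0) (s u.succ)) (lam u))| *
            0 + 0))) := by
        refine tendsto_finsetSum _ fun u hu => Filter.Tendsto.const_mul _ ?_
        refine Filter.Tendsto.add (Filter.Tendsto.const_mul _ ?_) ?_
        · refine tendsto_pow_atTop_nhds_zero_of_lt_one (Real.exp_pos _).le ?_
          rw [Real.exp_lt_one_iff]
          exact hexp u (by simpa using hu)
        · refine tendsto_pow_atTop_nhds_zero_of_lt_one (Real.exp_pos _).le ?_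
          rw [Real.exp_lt_one_iff]
          linarith [hδ u]
      simpa using h1
    refine squeeze_zero hnn (fun q => (hc q).trans ?_)
      (hE.comp (Filter.tendsto_add_atTop_nat 1))
    refine Finset.sum_le_sum fun u hu => mul_le_mul_of_nonneg_left ?_ (Nat.cast_nonneg _)
    have hu' : A.Active u := by simpa using hu
    refine add_le_add ?_ (le_of_eq ?_)
    · refine exp_mul_pow_mul_prod_le _ ?_ ?_ r (δ u) (lam u) (m' q) (q + 1) (hm1 q) (hm2 q)
      · exact negMoment_pos _ _ hpS.1 hpS.2 (hA.side_pos u hu') _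
      · intro k hk
        exact negMoment_pos _ _ (hA.letterOutputLaw_nonneg hW) (hA.sum_letterOutputLaw hW)
          (hA.chan_pos u hu' k (Finset.mem_range.1 hk)) _
    · rw [one_div, ← Real.exp_neg, ← Real.exp_nat_mul]
      congr 1
      ring

end Scheme

/-! ### Laws, entropy and mutual information as expectations -/

section Law

variable {Ω α β : Type*} [Fintype Ω]

theorem law_nonneg {p : Ω → ℝ} (hp : ∀ ω, 0 ≤ p ω) (f : Ω → α) (a : α) : 0 ≤ law p f a := by
  refine Finset.sum_nonneg fun ω _ => ?_
  split_ifs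
  · exact hp ω
  · exact le_rfl

theorem law_pos {p : Ω → ℝ} (hp : ∀ ω, 0 ≤ p ω) (f : Ω → α) {ω : Ω} (h : 0 < p ω) :
    0 < law p f (f ω) := by
  refine Finset.sum_pos' (fun ω _ => ?_) ⟨ω, Finset.mem_univ _, by simpa using h⟩
  split_ifs
  · exact hp ω
  · exact le_rfl

theorem law_congr (p : Ω → ℝ) {f : Ω → α} {g : Ω → β} {a : α} {b : β}
    (h : ∀ ω, f ω = a ↔ g ω = b) : law p f a = law p g b := by
  unfold law
  refine Finset.sum_congr rfl fun ω _ => ?_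
  by_cases hf : f ω = a
  · rw [if_pos hf, if_pos ((h ω).1 hf)]
  · rw [if_neg hf, if_neg (fun hg => hf ((h ω).2 hg))]

theorem sum_law_mul [Fintype α] (p : Ω → ℝ) (f : Ω → α) (F : α → ℝ) :
    ∑ a, law p f a * F a = ∑ ω, p ω * F (f ω) := by
  classical
  unfold law
  simp only [Finset.sum_mul]
  rw [Finset.sum_comm]
  refine Finset.sum_congr rfl fun ω _ => ?_
  simp [ite_mul]

theorem sum_law_prod_left [Fintype α] (p : Ω → ℝ) (f : Ω → α) (g : Ω → β) (b : β) :
    ∑ a, law p (fun ω => (f ω, g ω)) (a, b) = law p g b := by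
  classical
  unfold law
  rw [Finset.sum_comm]
  refine Finset.sum_congr rfl fun ω _ => ?_
  by_cases h : g ω = b <;> simp [h]

theorem law_prod_le {p : Ω → ℝ} (hp : ∀ ω, 0 ≤ p ω) (f : Ω → α) (g : Ω → β) (a : α) (b : β) :
    law p (fun ω => (f ω, g ω)) (a, b) ≤ law p g b := by
  unfold law
  refine Finset.sum_le_sum fun ω _ => ?_
  by_cases h : g ω = b
  · simp only [h, if_true]
    split_ifs
    · exact le_rfl
    · exact hp ω
  · simp [h]

theorem condEntropy_eq_sum [Fintype α] [Fintype β] (p : Ω → ℝ) (f : Ω → α) (g : Ω → β) :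
    condEntropy p f g = ∑ ω, p ω * Real.log (law p g (g ω) /
      law p (fun ω => (f ω, g ω)) (f ω, g ω)) := by
  unfold condEntropy
  rw [← Fintype.sum_prod_type (f := fun ab : α × β => law p (fun ω => (f ω, g ω)) ab *
    Real.log (law p g ab.2 / law p (fun ω => (f ω, g ω)) ab))]
  exact sum_law_mul p (fun ω => (f ω, g ω))
    (fun ab => Real.log (law p g ab.2 / law p (fun ω => (f ω, g ω)) ab))

theorem condEntropy_term_nonneg {p : Ω → ℝ} (hp : ∀ ω, 0 ≤ p ω) (f : Ω → α) (g : Ω → β) (ω : Ω) :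
    0 ≤ p ω * Real.log (law p g (g ω) / law p (fun ω => (f ω, g ω)) (f ω, g ω)) := by
  rcases (hp ω).eq_or_lt with h | h
  · simp [← h]
  · refine mul_nonneg h.le (Real.log_nonneg ?_)
    rw [le_div_iff₀ (law_pos hp (fun ω => (f ω, g ω)) h), one_mul]
    exact law_prod_le hp f g _ _

theorem condEntropy_nonneg [Fintype α] [Fintype β] {p : Ω → ℝ} (hp : ∀ ω, 0 ≤ p ω) (f : Ω → α)
    (g : Ω → β) : 0 ≤ condEntropy p f g := by
  rw [condEntropy_eq_sum]
  exact Finset.sum_nonneg fun ω _ => condEntropy_term_nonneg hp f g ω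

/-- The entropy is a sum of nonnegative terms, so each logarithm vanishes on the support. -/
theorem law_eq_of_condEntropy_eq_zero [Fintype α] [Fintype β] {p : Ω → ℝ} (hp : ∀ ω, 0 ≤ p ω)
    (f : Ω → α) (g : Ω → β) (h : condEntropy p f g = 0) {ω : Ω} (hω : 0 < p ω) :
    law p (fun ω => (f ω, g ω)) (f ω, g ω) = law p g (g ω) := by
  rw [condEntropy_eq_sum, Finset.sum_eq_zero_iff_of_nonneg
    (fun ω _ => condEntropy_term_nonneg hp f g ω)] at h
  have h1 := (mul_eq_zero.1 (h ω (Finset.mem_univ _))).resolve_left hω.ne'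
  have hfg := law_pos hp (fun ω => (f ω, g ω)) hω
  have hg := law_pos hp g hω
  have h2 := Real.eq_one_of_pos_of_log_eq_zero (div_pos hg hfg) h1
  rw [div_eq_one_iff_eq hfg.ne'] at h2
  exact h2.symm

theorem condMutualInfo_eq_sum {γ : Type*} [Fintype α] [Fintype β] [Fintype γ] (p : Ω → ℝ)
    (f : Ω → α) (g : Ω → β) (h : Ω → γ) :
    condMutualInfo p f g h = ∑ ω, p ω * Real.log
      (law p (fun ω => (f ω, g ω, h ω)) (f ω, g ω, h ω) * law p h (h ω) /
      (law p (fun ω => (f ω, h ω)) (f ω, h ω) * law p (fun ω => (g ω, h ω)) (g ω, h ω))) := by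
  unfold condMutualInfo
  rw [← sum_law_mul p (fun ω => (f ω, g ω, h ω)) (fun a => Real.log
      (law p (fun ω => (f ω, g ω, h ω)) a * law p h a.2.2 /
      (law p (fun ω => (f ω, h ω)) (a.1, a.2.2) * law p (fun ω => (g ω, h ω)) a.2)))]
  simp only [Fintype.sum_prod_type]

end Law

/-! ### Resampling, conditional kernels and random strategies -/

section Resampling

/-- Replacing one coordinate by an independent copy preserves a product law. The copy is the index
`none`, and `e` reads it in place of `i`. -/
theorem sum_prod_resample {I V : Type*} [Fintype I] [DecidableEq I] [Fintype V]
    (q : I → V → ℝ) (hq : ∀ i, ∑ v, q i v = 1) (i : I) (F : (I → V) → ℝ) :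
    ∑ v : I → V, (∏ j, q j (v j)) * F v =
      ∑ v : I → V, (∏ j, q j (v j)) * ∑ c, q i c * F (Function.update v i c) := by
  let q' : Option I → V → ℝ := fun o => o.elim (q i) q
  have hq' : ∀ o, ∑ v, q' o v = 1 := by
    rintro (_ | j)
    · exact hq i
    · exact hq j
  let e : I → Option I := fun j => if j = i then none else some j
  have he : Function.Injective e := by
    intro j j' h
    by_cases h1 : j = i <;> by_cases h2 : j' = i <;> simp_all [e]
  have hqe : ∀ j, q' (e j) = q j := by
    intro j
    by_cases h : j = i <;> simp [e, q', h]
  have h1 := sum_prod_mul_comp q' hq' e he F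
  simp only [hqe] at h1
  rw [← h1, ← Fintype.sum_equiv (Equiv.piOptionEquivProd (β := fun _ => V)).symm _ _ (fun _ => rfl),
    Fintype.sum_prod_type, Finset.sum_comm]
  refine Finset.sum_congr rfl fun v _ => ?_
  rw [Finset.mul_sum]
  refine Finset.sum_congr rfl fun c _ => ?_
  have h2 : ((Equiv.piOptionEquivProd (β := fun _ : Option I => V)).symm (c, v)) ∘ e
      = Function.update v i c := by
    funext j
    by_cases h : j = i
    · subst h; simp [e, Equiv.piOptionEquivProd]
    · simp [e, h, Equiv.piOptionEquivProd]
  rw [h2, Fintype.prod_option]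
  simp only [Equiv.piOptionEquivProd, Equiv.coe_fn_symm_mk, q', Option.elim]
  ring

end Resampling

section Kernel

variable {K : ℕ} {X : Fin (K + 1) → Type*}

theorem sub_eq_iff {A : Finset (Fin (K + 1))} {x x' : ∀ j, X j} :
    sub A x = sub A x' ↔ ∀ j ∈ A, x j = x' j := by
  constructor
  · intro h j hj
    exact congrFun h ⟨j, hj⟩
  · intro h
    funext j
    exact h j.1 j.2

variable [∀ j, Fintype (X j)]

open Classical in
/-- The conditional law of the tuple of inputs, given its coordinates in `A`. -/
noncomputable def condKer (p : (∀ j, X j) → ℝ) (A : Finset (Fin (K + 1))) (x x' : ∀ j, X j) : ℝ :=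
  -- On null events the kernel falls back to `p`, so that it always has mass one.
  if law p (sub A) (sub A x) = 0 then p x'
  else if sub A x' = sub A x then p x' / law p (sub A) (sub A x) else 0

theorem condKer_nonneg {p : (∀ j, X j) → ℝ} (hp : ∀ x, 0 ≤ p x) (A : Finset (Fin (K + 1)))
    (x x' : ∀ j, X j) : 0 ≤ condKer p A x x' := by
  unfold condKer
  split_ifs
  · exact hp _
  · exact div_nonneg (hp _) (law_nonneg hp _ _)
  · exact le_rfl

theorem sum_condKer {p : (∀ j, X j) → ℝ} (hs : ∑ x, p x = 1) (A : Finset (Fin (K + 1)))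
    (x : ∀ j, X j) : ∑ x', condKer p A x x' = 1 := by
  classical
  unfold condKer
  split_ifs with h
  · exact hs
  · have e : ∑ x', (if sub A x' = sub A x then p x' else 0) = law p (sub A) (sub A x) := by
      unfold law
      exact Finset.sum_congr rfl fun x' _ => by congr
    calc _ = (∑ x', (if sub A x' = sub A x then p x' else 0)) / law p (sub A) (sub A x) := by
          rw [Finset.sum_div]
          refine Finset.sum_congr rfl fun x' _ => ?_
          by_cases h' : sub A x' = sub A x <;> simp [h']
      _ = 1 := by rw [e, div_self h]

theorem condKer_congr (p : (∀ j, X j) → ℝ) {A : Finset (Fin (K + 1))} {x₁ x₂ : ∀ j, X j}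
    (h : sub A x₁ = sub A x₂) : condKer p A x₁ = condKer p A x₂ := by
  unfold condKer
  rw [h]

/-- If `x` has law `p` and `x'` is drawn given `x_A`, then `(x_A, x')` is distributed like `(x_A,
x)`. This is why `G` may depend on its first argument only through `A`. -/
theorem sum_mul_condKer {p : (∀ j, X j) → ℝ} (hp : ∀ x, 0 ≤ p x) (A : Finset (Fin (K + 1)))
    (G : (∀ j, X j) → (∀ j, X j) → ℝ)
    (hG : ∀ x₁ x₂ x', sub A x₁ = sub A x₂ → G x₁ x' = G x₂ x') :
    ∑ x, p x * ∑ x', condKer p A x x' * G x x' = ∑ x, p x * G x x := by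
  classical
  simp only [Finset.mul_sum]
  rw [Finset.sum_comm]
  refine Finset.sum_congr rfl fun x' _ => ?_
  rcases (hp x').eq_or_lt with h | h
  · rw [← h, zero_mul]
    refine Finset.sum_eq_zero fun x _ => ?_
    unfold condKer
    split_ifs <;> simp [← h]
  · have hL := law_pos hp (sub A) h
    calc _ = ∑ x, (if sub A x = sub A x' then p x else 0) *
          (p x' / law p (sub A) (sub A x') * G x' x') := by
          refine Finset.sum_congr rfl fun x _ => ?_
          rcases (hp x).eq_or_lt with h0 | h0
          · simp [← h0]
          · have hL' := law_pos hp (sub A) h0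
            unfold condKer
            rw [if_neg hL'.ne']
            by_cases e : sub A x = sub A x'
            · rw [if_pos e.symm, if_pos e, e, hG x x' x' e]
            · rw [if_neg (Ne.symm e), if_neg e]
              ring
      _ = law p (sub A) (sub A x') * (p x' / law p (sub A) (sub A x') * G x' x') := by
          rw [← Finset.sum_mul]
          congr 1
          unfold law
          exact Finset.sum_congr rfl fun x _ => by congr
      _ = p x' * G x' x' := by
          field_simp

end Kernel

section Strategies

/-- A letter of the random code: a map of input tuples, which tells a transmitter how to choose its
input, given the inputs of the transmitters of higher levels. -/
abbrev Strategy {K : ℕ} (X : Fin (K + 1) → Type*) := (∀ j, X j) → ∀ j, X j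

variable {K N : ℕ} {X : Fin (K + 1) → Type*} (tx : Fin N → Fin (K + 1)) (x₀ : ∀ j, X j)

/-- The transmitters of the levels `k, …, N - 1`. -/
def tail (k : ℕ) : Finset (Fin (K + 1)) := {j | ∃ l : Fin N, k ≤ l.1 ∧ tx l = j}

/-- The input tuple after the letters of the levels `N, …, N - i` have been applied. -/
def stage (v : Fin (N + 1) → Strategy X) : ℕ → ∀ j, X j
  -- The letter of level `N` fills the whole tuple, including the inputs outside `π`. Its law
  -- conditions on no coordinates, so the choice of `x₀` does not affect the resulting distribution.
  | 0 => v (Fin.last N) x₀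
  | i + 1 => if h : i < N then
      Function.update (stage v i) (tx ⟨N - 1 - i, by omega⟩)
        (v ⟨N - 1 - i, by omega⟩ (stage v i) (tx ⟨N - 1 - i, by omega⟩))
    else stage v i

variable {tx x₀}

theorem mem_tail {k : ℕ} {j : Fin (K + 1)} : j ∈ tail tx k ↔ ∃ l : Fin N, k ≤ l.1 ∧ tx l = j := by
  simp [tail]

theorem tail_mono {k k' : ℕ} (h : k ≤ k') : tail tx k' ⊆ tail tx k := by
  intro j hj
  obtain ⟨l, hl, e⟩ := mem_tail.1 hj
  exact mem_tail.2 ⟨l, h.trans hl, e⟩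

theorem mem_tail_iff {k : Fin N} {j : Fin (K + 1)} :
    j ∈ tail tx k ↔ j = tx k ∨ j ∈ tail tx (k + 1) := by
  simp only [mem_tail]
  constructor
  · rintro ⟨l, hl, rfl⟩
    rcases hl.eq_or_lt with h | h
    · exact Or.inl (by rw [Fin.ext h])
    · exact Or.inr ⟨l, h, rfl⟩
  · rintro (rfl | ⟨l, hl, rfl⟩)
    · exact ⟨k, le_rfl, rfl⟩
    · exact ⟨l, by omega, rfl⟩

theorem notMem_tail_succ (htx : Function.Injective tx) (k : Fin N) : tx k ∉ tail tx (k + 1) := by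
  intro h
  obtain ⟨l, hl, e⟩ := mem_tail.1 h
  have := htx e
  subst this
  omega

theorem stage_succ (v : Fin (N + 1) → Strategy X) (k : Fin N) :
    stage tx x₀ v (N - k) = Function.update (stage tx x₀ v (N - 1 - k)) (tx k)
      (v k.castSucc (stage tx x₀ v (N - 1 - k)) (tx k)) := by
  have h1 : N - k = (N - 1 - k) + 1 := by omega
  have h2 : N - 1 - k < N := by omega
  have h3 : (⟨N - 1 - (N - 1 - k), by omega⟩ : Fin N) = k := Fin.ext (by simp; omega)
  have h4 : (⟨N - 1 - (N - 1 - k), by omega⟩ : Fin (N + 1)) = k.castSucc :=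
    Fin.ext (by simp; omega)
  rw [h1, stage, dif_pos h2, h3, h4]

theorem stage_congr {v v' : Fin (N + 1) → Strategy X} (i : ℕ)
    (h : ∀ l : Fin (N + 1), N - i ≤ l.1 → v l = v' l) : stage tx x₀ v i = stage tx x₀ v' i := by
  induction i with
  | zero => simp only [stage, h (Fin.last N) (by simp)]
  | succ i ih =>
    have ih' := ih fun l hl => h l (by omega)
    unfold stage
    split_ifs with hi
    · rw [ih', h ⟨N - 1 - i, by omega⟩ (by simp; omega)]
    · exact ih'

/-- Each further stage changes only the coordinate of its own transmitter. -/
theorem stage_stable (v : Fin (N + 1) → Strategy X) {j : Fin (K + 1)} {i : ℕ}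
    (hj : ∀ l : Fin N, l.1 < N - i → tx l ≠ j) (i' : ℕ) (hi : i ≤ i') :
    stage tx x₀ v i' j = stage tx x₀ v i j := by
  induction i', hi using Nat.le_induction with
  | base => rfl
  | succ i' hi ih =>
    rw [stage]
    split_ifs with h
    · rw [Function.update_of_ne, ih]
      exact (hj ⟨N - 1 - i', by omega⟩ (by change N - 1 - i' < N - i; omega)).symm
    · exact ih

theorem stage_update (v : Fin (N + 1) → Strategy X) (k : Fin N) (c : Strategy X) :
    stage tx x₀ (Function.update v k.castSucc c) (N - k) =
      Function.update (stage tx x₀ v (N - 1 - k)) (tx k) (c (stage tx x₀ v (N - 1 - k)) (tx k)) := by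
  rw [stage_succ, Function.update_self]
  have : stage tx x₀ (Function.update v k.castSucc c) (N - 1 - k) = stage tx x₀ v (N - 1 - k) := by
    apply stage_congr
    intro l hl
    rw [Function.update_of_ne]
    intro e
    have := congrArg Fin.val e
    simp only [Fin.val_castSucc] at this
    omega
  rw [this]

variable (tx) [∀ j, Fintype (X j)]

/-- The law of the letters of each level. -/
noncomputable def strategyLaw (p : (∀ j, X j) → ℝ) (l : Fin (N + 1)) (v : Strategy X) : ℝ :=
  ∏ x, condKer p (tail tx (l + 1)) x (v x)

variable {tx}

theorem strategyLaw_nonneg {p : (∀ j, X j) → ℝ} (hp : ∀ x, 0 ≤ p x) (l : Fin (N + 1))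
    (v : Strategy X) : 0 ≤ strategyLaw tx p l v :=
  Finset.prod_nonneg fun _ _ => condKer_nonneg hp _ _ _

variable [DecidableEq (∀ j, X j)]

theorem sum_strategyLaw {p : (∀ j, X j) → ℝ} (hs : ∑ x, p x = 1) (l : Fin (N + 1)) :
    ∑ v, strategyLaw tx p l v = 1 :=
  sum_prod_eq_one (V := fun _ : (∀ j, X j) => ∀ j, X j)
    (fun x x' => condKer p (tail tx (l + 1)) x x') fun x => sum_condKer hs _ x

theorem sum_strategyLaw_mul {p : (∀ j, X j) → ℝ} (hs : ∑ x, p x = 1) (l : Fin (N + 1))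
    (x : ∀ j, X j) (F : (∀ j, X j) → ℝ) :
    ∑ v, strategyLaw tx p l v * F (v x) = ∑ x', condKer p (tail tx (l + 1)) x x' * F x' :=
  sum_prod_mul_apply (fun x x' => condKer p (tail tx (l + 1)) x x')
    (fun x => sum_condKer hs _ x) x F

/-- The tuple that agrees with `x₁` on `A` and with `x₂` elsewhere. -/
def mix (A : Finset (Fin (K + 1))) (x₁ x₂ : ∀ j, X j) : ∀ j, X j :=
  fun j => if j ∈ A then x₁ j else x₂ j

/-- The coordinates already set by their own levels have the right joint law; the others still come
from the level `N` letter, as an independent copy. One more stage draws the next coordinate given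
the coordinates of the higher levels, which `sum_mul_condKer` identifies with its value in `x₁`. -/
theorem sum_strategies_stage {p : (∀ j, X j) → ℝ} (hp : ∀ x, 0 ≤ p x) (hs : ∑ x, p x = 1)
    (i : ℕ) (hi : i ≤ N) (F : (∀ j, X j) → ℝ) :
    ∑ v : Fin (N + 1) → Strategy X, (∏ l, strategyLaw tx p l (v l)) * F (stage tx x₀ v i) =
      ∑ x₁, p x₁ * ∑ x₂, p x₂ * F (mix (tail tx (N - i)) x₁ x₂) := by
  induction i generalizing F with
  | zero =>
    have h1 := sum_prod_mul_apply (fun l v => strategyLaw tx p l v) (sum_strategyLaw hs)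
      (Fin.last N) (fun v => F (v x₀))
    refine h1.trans ?_
    rw [sum_strategyLaw_mul hs]
    have h2 : ∀ k, N ≤ k → tail tx k = ∅ := by
      intro k hk
      ext j
      simp only [mem_tail, Finset.notMem_empty, iff_false]
      rintro ⟨l, hl, -⟩
      omega
    have h3 : ∀ x x', condKer p (tail tx ((Fin.last N : Fin (N + 1)) + 1 : ℕ)) x x' = p x' := by
      intro x x'
      rw [h2 _ (by simp)]
      have h4 : ∀ x x' : ∀ j, X j, sub ∅ x = sub ∅ x' := fun x x' => sub_eq_iff.2 (by simp)
      have h5 : law p (sub ∅) (sub ∅ x) = 1 := by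
        unfold law
        simp only [h4 _ x, if_true, hs]
      unfold condKer
      rw [h5, if_neg one_ne_zero, if_pos (h4 _ _), div_one]
    have h6 : ∀ x₁ x₂ : ∀ j, X j, mix ∅ x₁ x₂ = x₂ := fun x₁ x₂ => by
      funext j
      simp [mix]
    simp only [h3, h2 (N - 0) (by simp), h6]
    rw [← Finset.sum_mul, hs, one_mul]
  | succ i ih =>
    obtain ⟨k, hk⟩ : ∃ k : Fin N, i = N - 1 - k := ⟨⟨N - 1 - i, by omega⟩, by simp; omega⟩
    have hk1 : i + 1 = N - k := by omega
    have hk2 : N - i = k + 1 := by omega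
    have hk3 : N - (N - k) = k := by omega
    rw [hk1, hk3, sum_prod_resample (fun l v => strategyLaw tx p l v) (sum_strategyLaw hs)
      k.castSucc]
    simp only [stage_update, ← hk]
    have h1 : ∀ x : ∀ j, X j, ∑ c, strategyLaw tx p k.castSucc c *
        F (Function.update x (tx k) (c x (tx k))) =
        ∑ x', condKer p (tail tx (k + 1)) x x' * F (Function.update x (tx k) (x' (tx k))) :=
      fun x => sum_strategyLaw_mul hs k.castSucc x
        (fun x' => F (Function.update x (tx k) (x' (tx k))))
    simp only [h1]
    rw [ih (by omega) (fun x => ∑ x', condKer p (tail tx (k + 1)) x x' *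
      F (Function.update x (tx k) (x' (tx k)))), hk2]
    have swap : ∀ H : (∀ j, X j) → (∀ j, X j) → ℝ,
        ∑ x₁, p x₁ * ∑ x₂, p x₂ * H x₁ x₂ = ∑ x₂, p x₂ * ∑ x₁, p x₁ * H x₁ x₂ := by
      intro H
      simp only [Finset.mul_sum]
      rw [Finset.sum_comm]
      refine Finset.sum_congr rfl fun x₂ _ => Finset.sum_congr rfl fun x₁ _ => by ring
    refine (swap _).trans (Eq.trans ?_ (swap _).symm)
    refine Finset.sum_congr rfl fun x₂ _ => ?_
    congr 1
    have h2 : ∀ x₁, condKer p (tail tx (k + 1)) (mix (tail tx (k + 1)) x₁ x₂) =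
        condKer p (tail tx (k + 1)) x₁ := by
      intro x₁
      apply condKer_congr
      rw [sub_eq_iff]
      intro j hj
      simp [mix, hj]
    simp only [h2]
    rw [sum_mul_condKer hp (tail tx (k + 1)) (fun x₁ x' =>
      F (Function.update (mix (tail tx (k + 1)) x₁ x₂) (tx k) (x' (tx k))))]
    · refine Finset.sum_congr rfl fun x₁ _ => ?_
      congr 2
      funext j
      by_cases e : j = tx k
      · subst e
        simp [mix, mem_tail_iff]
      · simp [mix, mem_tail_iff, e]
    · intro x₁ x₁' x' h
      congr 2
      funext j
      unfold mix
      split_ifs with hj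
      · exact sub_eq_iff.1 h j hj
      · rfl

/-- If the inputs of the transmitters are independent of the others, the random strategies
produce the prescribed law of the inputs. -/
theorem sum_strategies {p : (∀ j, X j) → ℝ} (hp : ∀ x, 0 ≤ p x) (hs : ∑ x, p x = 1)
    (hind : IndepOfRest p (tail tx 0)) (F : (∀ j, X j) → ℝ) :
    ∑ v : Fin (N + 1) → Strategy X, (∏ l, strategyLaw tx p l (v l)) * F (stage tx x₀ v N) =
      ∑ x, p x * F x := by
  classical
  rw [sum_strategies_stage hp hs N le_rfl, Nat.sub_self]
  set A := tail tx 0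
  have h1 : ∀ x₁ x₂ : ∀ j, X j, F (mix A x₁ x₂) =
      ∑ x, (if sub A x₁ = sub A x then 1 else 0) * (if sub Aᶜ x₂ = sub Aᶜ x then 1 else 0) *
        F x := by
    intro x₁ x₂
    rw [Finset.sum_eq_single (mix A x₁ x₂)]
    · rw [if_pos, if_pos]
      · ring
      · rw [sub_eq_iff]
        intro j hj
        have : j ∉ A := by simpa using hj
        simp [mix, this]
      · rw [sub_eq_iff]
        intro j hj
        simp [mix, hj]
    · intro x _ hx
      by_cases e1 : sub A x₁ = sub A x
      · by_cases e2 : sub Aᶜ x₂ = sub Aᶜ x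
        · exfalso
          apply hx
          funext j
          by_cases hj : j ∈ A
          · simp [mix, hj, sub_eq_iff.1 e1 j hj]
          · simp [mix, hj, sub_eq_iff.1 e2 j (by simpa using hj)]
        · simp [e2]
      · simp [e1]
    · simp
  simp only [h1, Finset.mul_sum]
  rw [Finset.sum_congr rfl fun x₁ _ => Finset.sum_comm, Finset.sum_comm]
  refine Finset.sum_congr rfl fun x _ => ?_
  conv_rhs => rw [hind x]
  unfold law
  rw [Finset.sum_mul_sum, Finset.sum_mul]
  refine Finset.sum_congr rfl fun x₁ _ => ?_
  rw [Finset.sum_mul]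
  refine Finset.sum_congr rfl fun x₂ _ => ?_
  by_cases e1 : sub A x₁ = sub A x <;> by_cases e2 : sub Aᶜ x₂ = sub Aᶜ x <;> simp [e1, e2]
  ring

end Strategies

/-! ### Likelihood ratios -/

section Ratio

variable {K : ℕ} {X : Fin (K + 1) → Type*} [∀ j, Fintype (X j)]

/-- The factor by which the coordinates in `A'`, rather than those in `A`, increase the density of
`w` with respect to `p`. -/
noncomputable def ratio (p w : (∀ j, X j) → ℝ) (A A' : Finset (Fin (K + 1))) (x : ∀ j, X j) : ℝ :=
  law w (sub A') (sub A' x) * law p (sub A) (sub A x) /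
    (law w (sub A) (sub A x) * law p (sub A') (sub A' x))

theorem ratio_nonneg {p w : (∀ j, X j) → ℝ} (hp : ∀ x, 0 ≤ p x) (hw : ∀ x, 0 ≤ w x)
    (A A' : Finset (Fin (K + 1))) (x : ∀ j, X j) : 0 ≤ ratio p w A A' x :=
  div_nonneg (mul_nonneg (law_nonneg hw _ _) (law_nonneg hp _ _))
    (mul_nonneg (law_nonneg hw _ _) (law_nonneg hp _ _))

theorem ratio_congr (p w : (∀ j, X j) → ℝ) {A A' : Finset (Fin (K + 1))} (hA : A ⊆ A')
    {x x' : ∀ j, X j} (h : sub A' x = sub A' x') : ratio p w A A' x = ratio p w A A' x' := by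
  have h2 : sub A x = sub A x' := sub_eq_iff.2 fun j hj => sub_eq_iff.1 h j (hA hj)
  unfold ratio
  rw [h, h2]

/-- With `g` the probability of an output `y`, the ratio is `P(y | x_{A'}) / P(y | x_A)`, and
averaging its numerator given `x_A` gives its denominator. Equality can fail only through vanishing
denominators. -/
theorem sum_condKer_mul_ratio_le {p g : (∀ j, X j) → ℝ} (hp : ∀ x, 0 ≤ p x) (hg : ∀ x, 0 ≤ g x)
    {A A' : Finset (Fin (K + 1))} (hA : A ⊆ A') (x : ∀ j, X j)
    (hx : law p (sub A) (sub A x) ≠ 0) :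
    ∑ x', condKer p A x x' * ratio p (fun x => p x * g x) A A' x' ≤ 1 := by
  classical
  set w : (∀ j, X j) → ℝ := fun x => p x * g x with hwdef
  have hw : ∀ x, 0 ≤ w x := fun x => mul_nonneg (hp x) (hg x)
  set L := law w (sub A) (sub A x) with hL
  have hL0 : 0 ≤ L := law_nonneg hw _ _
  have h1 : ∀ x', condKer p A x x' * ratio p w A A' x' =
      (∑ x'', if sub A' x'' = sub A' x' then
        (if sub A x'' = sub A x then p x' * (w x'' / law p (sub A') (sub A' x'')) else 0) else 0) /
          L := by
    intro x'
    unfold condKer ratio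
    rw [if_neg hx]
    by_cases e : sub A x' = sub A x
    · have h2 : ∀ x'', (if sub A' x'' = sub A' x' then
          (if sub A x'' = sub A x then p x' * (w x'' / law p (sub A') (sub A' x'')) else 0) else 0)
          = (if sub A' x'' = sub A' x' then w x'' else 0) *
            (p x' / law p (sub A') (sub A' x')) := by
        intro x''
        by_cases e' : sub A' x'' = sub A' x'
        · have e2 : sub A x'' = sub A x := by
            rw [← e]
            exact sub_eq_iff.2 fun j hj => sub_eq_iff.1 e' j (hA hj)
          rw [if_pos e', if_pos e', if_pos e2, e']
          ring
        · rw [if_neg e', if_neg e', zero_mul]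
      rw [if_pos e, e, Finset.sum_congr rfl fun x'' _ => h2 x'', ← Finset.sum_mul]
      have h3 : law w (sub A') (sub A' x') = ∑ x'', if sub A' x'' = sub A' x' then w x'' else 0 := by
        unfold law
        exact Finset.sum_congr rfl fun x _ => by congr
      rw [← h3, ← hL]
      field_simp
    · rw [if_neg e, zero_mul]
      symm
      rw [div_eq_zero_iff]
      left
      refine Finset.sum_eq_zero fun x'' _ => ?_
      by_cases e' : sub A' x'' = sub A' x'
      · have e2 : sub A x'' ≠ sub A x := by
          intro e2
          apply e
          rw [← e2]
          exact sub_eq_iff.2 fun j hj => (sub_eq_iff.1 e' j (hA hj)).symm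
        rw [if_pos e', if_neg e2]
      · rw [if_neg e']
  simp only [h1, ← Finset.sum_div]
  refine div_le_one_of_le₀ ?_ hL0
  rw [Finset.sum_comm]
  have h4 : L = ∑ x'', if sub A x'' = sub A x then w x'' else 0 := by
    rw [hL]
    unfold law
    exact Finset.sum_congr rfl fun x _ => by congr
  rw [h4]
  refine Finset.sum_le_sum fun x'' _ => ?_
  by_cases e : sub A x'' = sub A x
  · simp only [if_pos e]
    have h5 : ∀ x', (if sub A' x'' = sub A' x' then
        p x' * (w x'' / law p (sub A') (sub A' x'')) else 0) =
        (if sub A' x' = sub A' x'' then p x' else 0) *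
          (w x'' / law p (sub A') (sub A' x'')) := by
      intro x'
      by_cases e' : sub A' x'' = sub A' x'
      · rw [if_pos e', if_pos e'.symm]
      · rw [if_neg e', if_neg (Ne.symm e'), zero_mul]
    have h6 : law p (sub A') (sub A' x'') = ∑ x', if sub A' x' = sub A' x'' then p x' else 0 := by
      unfold law
      exact Finset.sum_congr rfl fun x _ => by congr
    rw [Finset.sum_congr rfl fun x' _ => h5 x', ← Finset.sum_mul, ← h6]
    rcases eq_or_ne (law p (sub A') (sub A' x'')) 0 with h0 | h0
    · rw [h0, zero_mul]
      exact hw _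
    · rw [mul_div_cancel₀ _ h0]
  · simp [e]

end Ratio

/-! ### Levels of the terminals along `π` -/

section Terminals

variable {K N : ℕ}

open Classical in
/-- The level of a terminal in the order `π`; it is `N` for terminals that do not cooperate. -/
noncomputable def termLevel (π : Fin (N + 1) → Fin (K + 2)) (t : Fin (K + 2)) : ℕ :=
  if h : ∃ l, π l = t then h.choose.1 else N

theorem termLevel_apply {π : Fin (N + 1) → Fin (K + 2)} (hπ : Function.Injective π)
    (l : Fin (N + 1)) : termLevel π (π l) = l := by
  have h : ∃ l', π l' = π l := ⟨l, rfl⟩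
  unfold termLevel
  rw [dif_pos h, hπ h.choose_spec]

theorem termLevel_le (π : Fin (N + 1) → Fin (K + 2)) (t : Fin (K + 2)) : termLevel π t ≤ N := by
  unfold termLevel
  split_ifs with h
  · omega
  · exact le_rfl

theorem exists_of_termLevel_lt {π : Fin (N + 1) → Fin (K + 2)} {t : Fin (K + 2)}
    (h : termLevel π t < N) : ∃ l, π l = t := by
  by_contra hc
  unfold termLevel at h
  rw [dif_neg hc] at h
  exact lt_irrefl _ h

variable {π : Fin (N + 1) → Fin (K + 2)} {tx : Fin N → Fin (K + 1)}

theorem tx_injective (hπ : Function.Injective π)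
    (htx : ∀ l : Fin N, π l.castSucc = (tx l).castSucc) : Function.Injective tx := by
  intro l l' h
  apply Fin.castSucc_injective N
  apply hπ
  rw [htx, htx, h]

theorem exists_level_iff (hπN : π (Fin.last N) = Fin.last (K + 1))
    (htx : ∀ l : Fin N, π l.castSucc = (tx l).castSucc) (P : ℕ → Prop) (j : Fin (K + 1)) :
    (∃ l : Fin (N + 1), P l.1 ∧ π l = j.castSucc) ↔ ∃ l : Fin N, P l.1 ∧ tx l = j := by
  constructor
  · rintro ⟨l, hl, e⟩
    rcases Fin.eq_castSucc_or_eq_last l with ⟨l, rfl⟩ | rfl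
    · rw [htx] at e
      exact ⟨l, hl, Fin.castSucc_injective _ e⟩
    · rw [hπN] at e
      exact absurd e.symm (Fin.castSucc_lt_last j).ne
  · rintro ⟨l, hl, rfl⟩
    exact ⟨l.castSucc, hl, htx l⟩

theorem after_eq (hπN : π (Fin.last N) = Fin.last (K + 1))
    (htx : ∀ l : Fin N, π l.castSucc = (tx l).castSucc) (i : Fin (N + 1)) :
    after π i = tail tx i := by
  ext j
  rw [mem_tail, ← exists_level_iff hπN htx (fun l => i.1 ≤ l)]
  simp only [after, Finset.mem_filter, Finset.mem_univ, true_and]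
  rfl

theorem cooperating_eq (hπN : π (Fin.last N) = Fin.last (K + 1))
    (htx : ∀ l : Fin N, π l.castSucc = (tx l).castSucc) : cooperating π = tail tx 0 := by
  ext j
  rw [mem_tail, ← exists_level_iff hπN htx (fun l => 0 ≤ l)]
  simp [cooperating]

theorem mem_before_or_tail (hπN : π (Fin.last N) = Fin.last (K + 1))
    (htx : ∀ l : Fin N, π l.castSucc = (tx l).castSucc) (i : Fin (N + 1)) (j : Fin (K + 1)) :
    j ∈ tail tx 0 ↔ j ∈ before π i ∨ j ∈ tail tx i := by
  have h : j ∈ before π i ↔ ∃ l : Fin N, l.1 < i.1 ∧ tx l = j := by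
    rw [← exists_level_iff hπN htx (fun l => l < i.1)]
    simp only [before, Finset.mem_filter, Finset.mem_univ, true_and]
    rfl
  rw [h, mem_tail, mem_tail]
  constructor
  · rintro ⟨l, -, e⟩
    rcases lt_or_ge l.1 i.1 with hl | hl
    · exact Or.inl ⟨l, hl, e⟩
    · exact Or.inr ⟨l, hl, e⟩
  · rintro (⟨l, -, e⟩ | ⟨l, -, e⟩) <;> exact ⟨l, Nat.zero_le _, e⟩

/-- The inputs of the levels from `k` on are final once the letter of level `k` has been applied,
hence do not depend on lower levels. -/
theorem sub_tail_stage {X : Fin (K + 1) → Type*} {x₀ : ∀ j, X j} (htx : Function.Injective tx)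
    (v : Fin (N + 1) → Strategy X) (k : ℕ) :
    sub (tail tx k) (stage tx x₀ v N) = sub (tail tx k) (stage tx x₀ v (N - k)) := by
  rw [sub_eq_iff]
  intro j hj
  obtain ⟨l, hl, rfl⟩ := mem_tail.1 hj
  refine stage_stable v ?_ N (by omega)
  intro l' hl' e
  rw [htx e] at hl'
  omega

end Terminals

/-! ### Channel outputs and the chain rule -/

section Output

variable {K : ℕ} {X Y : Fin (K + 1) → Type*} [∀ v, Fintype (Y v)]

open Classical in
/-- The probability of the output `y` of the receiver `u`, given the inputs. -/
noncomputable def outProb (W : (∀ j, X j) → (∀ v, Y v) → ℝ) (u : Fin (K + 1)) (y : Y u)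
    (x : ∀ j, X j) : ℝ :=
  ∑ z, if z u = y then W x z else 0

variable {W : (∀ j, X j) → (∀ v, Y v) → ℝ}

theorem outProb_nonneg (hW : ∀ x, W x ∈ stdSimplex ℝ (∀ v, Y v))
    (u : Fin (K + 1)) (y : Y u) (x : ∀ j, X j) : 0 ≤ outProb W u y x := by
  refine Finset.sum_nonneg fun z _ => ?_
  split_ifs
  · exact (hW x).1 z
  · exact le_rfl

theorem outProb_pos (hW : ∀ x, W x ∈ stdSimplex ℝ (∀ v, Y v))
    (u : Fin (K + 1)) {x : ∀ j, X j} {z : ∀ v, Y v} (h : 0 < W x z) :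
    0 < outProb W u (z u) x := by
  refine Finset.sum_pos' (fun z _ => ?_) ⟨z, Finset.mem_univ _, by simpa using h⟩
  split_ifs
  · exact (hW x).1 _
  · exact le_rfl

variable [∀ j, Fintype (X j)]

theorem law_jointLaw_sub (hW : ∀ x, W x ∈ stdSimplex ℝ (∀ v, Y v))
    (pX : (∀ j, X j) → ℝ) (A : Finset (Fin (K + 1))) (x : ∀ j, X j) :
    law (jointLaw pX W) (fun xy => sub A xy.1) (sub A x) = law pX (sub A) (sub A x) := by
  classical
  unfold law jointLaw
  rw [Fintype.sum_prod_type]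
  refine Finset.sum_congr rfl fun x' _ => ?_
  by_cases h : sub A x' = sub A x
  · simp only [h, if_true]
    rw [← Finset.mul_sum, (hW x').2, mul_one]
  · simp [h]

theorem law_jointLaw_output (pX : (∀ j, X j) → ℝ) (W : (∀ j, X j) → (∀ v, Y v) → ℝ)
    (A : Finset (Fin (K + 1)))
    (u : Fin (K + 1)) (x : ∀ j, X j) (y : Y u) :
    law (jointLaw pX W) (fun xy => (xy.2 u, sub A xy.1)) (y, sub A x) =
      law (fun x => pX x * outProb W u y x) (sub A) (sub A x) := by
  classical
  unfold law jointLaw outProb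
  rw [Fintype.sum_prod_type]
  refine Finset.sum_congr rfl fun x' _ => ?_
  by_cases h : sub A x' = sub A x
  · simp only [h, if_true, Prod.mk.injEq, and_true]
    rw [Finset.mul_sum]
    refine Finset.sum_congr rfl fun z _ => ?_
    by_cases h' : z u = y <;> simp [h']
  · simp [h]

variable {N : ℕ} {π : Fin (N + 1) → Fin (K + 2)} {tx : Fin N → Fin (K + 1)}

theorem log_ratio {p w : (∀ j, X j) → ℝ} (hp : ∀ x, 0 ≤ p x) (hw : ∀ x, 0 ≤ w x) {x : ∀ j, X j}
    (hpx : 0 < p x) (hwx : 0 < w x) (A A' : Finset (Fin (K + 1))) :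
    Real.log (ratio p w A A' x) =
      (Real.log (law w (sub A') (sub A' x)) - Real.log (law p (sub A') (sub A' x))) -
      (Real.log (law w (sub A) (sub A x)) - Real.log (law p (sub A) (sub A x))) := by
  have h1 := (law_pos hp (sub A) hpx).ne'
  have h2 := (law_pos hp (sub A') hpx).ne'
  have h3 := (law_pos hw (sub A) hwx).ne'
  have h4 := (law_pos hw (sub A') hwx).ne'
  unfold ratio
  rw [Real.log_div (mul_ne_zero h4 h1) (mul_ne_zero h3 h2), Real.log_mul h4 h1, Real.log_mul h3 h2]
  ring

theorem ratio_pos {p w : (∀ j, X j) → ℝ} (hp : ∀ x, 0 ≤ p x) (hw : ∀ x, 0 ≤ w x) {x : ∀ j, X j}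
    (hpx : 0 < p x) (hwx : 0 < w x) (A A' : Finset (Fin (K + 1))) : 0 < ratio p w A A' x :=
  div_pos (mul_pos (law_pos hw _ hwx) (law_pos hp _ hpx))
    (mul_pos (law_pos hw _ hwx) (law_pos hp _ hpx))

/-- Chain rule: the mutual information is the mean of the logarithm of a product of ratios. -/
theorem rateInfo_eq (hW : ∀ x, W x ∈ stdSimplex ℝ (∀ v, Y v))
    {pX : (∀ j, X j) → ℝ} (hp : ∀ x, 0 ≤ pX x) (hπN : π (Fin.last N) = Fin.last (K + 1))
    (htx : ∀ l : Fin N, π l.castSucc = (tx l).castSucc) (i : Fin (N + 1)) (u : Fin (K + 1)) :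
    rateInfo pX W π i u = ∑ k ∈ Finset.range i, ∑ x, pX x * ∑ z, W x z *
      Real.log (ratio pX (fun x => pX x * outProb W u (z u) x) (tail tx (k + 1)) (tail tx k) x) := by
  unfold rateInfo
  rw [condMutualInfo_eq_sum, after_eq hπN htx, Fintype.sum_prod_type]
  simp only [Finset.mul_sum]
  conv_rhs => rw [Finset.sum_comm]
  refine Finset.sum_congr rfl fun x _ => ?_
  conv_rhs => rw [Finset.sum_comm]
  refine Finset.sum_congr rfl fun z _ => ?_
  rw [← Finset.mul_sum, ← Finset.mul_sum, ← mul_assoc]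
  change pX x * W x z * _ = _
  rcases (hp x).eq_or_lt with h0 | h0
  · simp [← h0]
  rcases ((hW x).1 z).eq_or_lt with h1 | h1
  · simp [← h1]
  congr 1
  have hw : ∀ x, 0 ≤ pX x * outProb W u (z u) x := fun x =>
    mul_nonneg (hp x) (outProb_nonneg hW u _ x)
  have hwx : 0 < pX x * outProb W u (z u) x := mul_pos h0 (outProb_pos hW u h1)
  -- The transmitters before and from `i` on together make up `tail tx 0`.
  have e1 : law (jointLaw pX W) (fun xy => (sub (before π i) xy.1, xy.2 u, sub (tail tx i) xy.1))
      (sub (before π i) x, z u, sub (tail tx i) x) =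
      law (fun x => pX x * outProb W u (z u) x) (sub (tail tx 0)) (sub (tail tx 0) x) := by
    rw [← law_jointLaw_output]
    apply law_congr
    rintro ⟨x', z'⟩
    simp only [Prod.mk.injEq, sub_eq_iff, mem_before_or_tail hπN htx i]
    constructor
    · rintro ⟨h1, h2, h3⟩
      exact ⟨h2, fun j hj => hj.elim (h1 j) (h3 j)⟩
    · rintro ⟨h1, h2⟩
      exact ⟨fun j hj => h2 j (Or.inl hj), h1, fun j hj => h2 j (Or.inr hj)⟩
  have e2 : law (jointLaw pX W) (fun xy => (sub (before π i) xy.1, sub (tail tx i) xy.1))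
      (sub (before π i) x, sub (tail tx i) x) = law pX (sub (tail tx 0)) (sub (tail tx 0) x) := by
    rw [← law_jointLaw_sub hW]
    apply law_congr
    rintro ⟨x', z'⟩
    simp only [Prod.mk.injEq, sub_eq_iff, mem_before_or_tail hπN htx i]
    constructor
    · rintro ⟨h1, h3⟩
      exact fun j hj => hj.elim (h1 j) (h3 j)
    · intro h2
      exact ⟨fun j hj => h2 j (Or.inl hj), fun j hj => h2 j (Or.inr hj)⟩
  rw [e1, e2, law_jointLaw_sub hW, law_jointLaw_output]
  simp only [log_ratio hp hw h0 hwx]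
  -- Telescoping leaves `log (P(y | x_{tail 0}) / P(y | x_{tail i}))`, the information density.
  rw [Finset.sum_range_sub' (fun k => Real.log (law (fun x => pX x * outProb W u (z u) x)
    (sub (tail tx k)) (sub (tail tx k) x)) - Real.log (law pX (sub (tail tx k))
      (sub (tail tx k) x))), ← log_ratio hp hw h0 hwx]
  unfold ratio
  congr 2
  ring

end Output

/-! ### The concrete scheme and its validity -/

section DecodeForward

variable {K N : ℕ} {S : Fin (K + 2) → Type*} {X Y : Fin (K + 1) → Type*}
  [∀ i, Fintype (S i)] [∀ j, Fintype (X j)] [∀ v, Fintype (Y v)]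

/-- The conditional probability of a source symbol, given the side information of terminal
`u + 1`. -/
noncomputable def sideCond (pS : (∀ i, S i) → ℝ) (u : Fin (K + 1)) (c : S 0) (σ : S u.succ) : ℝ :=
  law pS (fun s => (s 0, s u.succ)) (c, σ) / law pS (fun s => s u.succ) σ

theorem sideCond_nonneg {pS : (∀ i, S i) → ℝ} (hp : ∀ s, 0 ≤ pS s) (u : Fin (K + 1)) (c : S 0)
    (σ : S u.succ) : 0 ≤ sideCond pS u c σ :=
  div_nonneg (law_nonneg hp _ _) (law_nonneg hp _ _)

theorem sideCond_pos {pS : (∀ i, S i) → ℝ} (hp : ∀ s, 0 ≤ pS s) (u : Fin (K + 1))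
    {s : ∀ i, S i} (hs : 0 < pS s) : 0 < sideCond pS u (s 0) (s u.succ) :=
  div_pos (law_pos hp (fun s => (s 0, s u.succ)) hs) (law_pos hp (fun s => s u.succ) hs)

theorem sum_sideCond_le {pS : (∀ i, S i) → ℝ} (u : Fin (K + 1))
    (σ : S u.succ) : ∑ c, sideCond pS u c σ ≤ 1 := by
  unfold sideCond
  rw [← Finset.sum_div, sum_law_prod_left pS (fun s => s 0) (fun s => s u.succ) σ]
  exact div_self_le_one _

theorem sum_log_sideCond (pS : (∀ i, S i) → ℝ) (u : Fin (K + 1)) :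
    ∑ s, pS s * Real.log (sideCond pS u (s 0) (s u.succ)) = -sourceEntropy pS u.succ := by
  unfold sourceEntropy
  rw [condEntropy_eq_sum, ← Finset.sum_neg_distrib]
  refine Finset.sum_congr rfl fun s _ => ?_
  rw [← mul_neg, ← Real.log_inv, inv_div]
  rfl

theorem sideCond_eq_one {pS : (∀ i, S i) → ℝ} (hp : ∀ s, 0 ≤ pS s) {u : Fin (K + 1)}
    (h : sourceEntropy pS u.succ = 0) {s : ∀ i, S i} (hs : 0 < pS s) :
    sideCond pS u (s 0) (s u.succ) = 1 := by
  unfold sideCond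
  rw [law_eq_of_condEntropy_eq_zero hp (fun s => s 0) (fun s => s u.succ) h hs]
  exact div_self (law_pos hp (fun s => s u.succ) hs).ne'

theorem sideCond_eq_zero {pS : (∀ i, S i) → ℝ} (hp : ∀ s, 0 ≤ pS s) {u : Fin (K + 1)}
    (h : sourceEntropy pS u.succ = 0) {s : ∀ i, S i} (hs : 0 < pS s) {c : S 0} (hc : c ≠ s 0) :
    sideCond pS u c (s u.succ) = 0 := by
  classical
  have h1 := sum_sideCond_le (pS := pS) u (s u.succ)
  have h2 : sideCond pS u (s 0) (s u.succ) + sideCond pS u c (s u.succ) ≤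
      ∑ c, sideCond pS u c (s u.succ) := by
    rw [← Finset.sum_pair (f := fun c => sideCond pS u c (s u.succ)) hc.symm]
    exact Finset.sum_le_sum_of_subset_of_nonneg (Finset.subset_univ _)
      fun c _ _ => sideCond_nonneg hp u c _
  rw [sideCond_eq_one hp h hs] at h2
  exact le_antisymm (by linarith) (sideCond_nonneg hp u c _)

open Classical in
/-- The decode-and-forward scheme along `π`.  Receivers whose side information determines the source
ignore the channel. -/
noncomputable def dfScheme (pS : (∀ i, S i) → ℝ) (W : (∀ j, X j) → (∀ v, Y v) → ℝ)
    (pX : (∀ j, X j) → ℝ) (x₀ : ∀ j, X j) {π : Fin (N + 1) → Fin (K + 2)}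
    (hπ : Function.Injective π) (hπ0 : π 0 = 0) (hπN : π (Fin.last N) = Fin.last (K + 1))
    {tx : Fin N → Fin (K + 1)} (htx : ∀ l : Fin N, π l.castSucc = (tx l).castSucc) :
    Scheme S X Y N (Strategy X) where
  letterLaw := strategyLaw tx pX
  inputMap v := stage tx x₀ v N
  level := termLevel π
  level_zero := by rw [← hπ0, termLevel_apply hπ]; rfl
  level_last := by rw [← hπN, termLevel_apply hπ]; rfl
  inputMap_congr j v v' h := by
    have hle := termLevel_le π j.castSucc
    have hj : ∀ l : Fin N, l.1 < N - (N - termLevel π j.castSucc) → tx l ≠ j := by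
      rintro l hl rfl
      rw [← htx, termLevel_apply hπ] at hl
      simp only [Fin.val_castSucc] at hl
      omega
    rw [stage_stable v hj N (by omega), stage_stable v' hj N (by omega),
      stage_congr _ fun l hl => h l (by omega)]
  -- At entropy zero the mutual information may vanish too, so a drift is created by hand: wrong
  -- blocks score zero, and the factor `2` gives the true block the drift `r * log 2`.
  sideScore u c σ := if sourceEntropy pS u.succ = 0 then 2 * sideCond pS u c σ
    else sideCond pS u c σ
  chanScore u k v y := if sourceEntropy pS u.succ = 0 then 1
    else ratio pX (fun x => pX x * outProb W u y x) (tail tx (k + 1)) (tail tx k) (stage tx x₀ v N)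
  chanScore_congr u k v v' y h := by
    split_ifs
    · rfl
    · apply ratio_congr _ _ (tail_mono (Nat.le_succ k))
      rw [sub_tail_stage (tx_injective hπ htx), sub_tail_stage (tx_injective hπ htx)]
      rw [sub_eq_iff]
      intro j hj
      obtain ⟨l, hl, rfl⟩ := mem_tail.1 hj
      rw [stage_congr _ fun l hl => h l (by omega)]

variable {pS : (∀ i, S i) → ℝ} {W : (∀ j, X j) → (∀ v, Y v) → ℝ}
    {pX : (∀ j, X j) → ℝ} {x₀ : ∀ j, X j} {π : Fin (N + 1) → Fin (K + 2)}
    {tx : Fin N → Fin (K + 1)}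

theorem sum_side_prod_le (hpS : ∀ s, 0 ≤ pS s) (u : Fin (K + 1)) (m : ℕ)
    (s : Fin m → ∀ i, S i) :
    ∑ c : Fin m → S 0, ∏ l, sideCond pS u (c l) (s l u.succ) ≤ 1 := by
  classical
  rw [← Fintype.prod_sum (fun l c => sideCond pS u c (s l u.succ))]
  exact Finset.prod_le_one (fun l _ => Finset.sum_nonneg fun c _ => sideCond_nonneg hpS _ _ _)
    (fun l _ => sum_sideCond_le _ _)

/-- The ratio sees only the levels from `k` on, so a fresh letter of level `k` amounts to drawing
the input of `tx k` given the higher inputs, and `sum_condKer_mul_ratio_le` applies. -/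
theorem sum_strategyLaw_mul_ratio_le [DecidableEq (∀ j, X j)] (hpX : pX ∈ stdSimplex ℝ (∀ j, X j))
    (htx : Function.Injective tx) {g : (∀ j, X j) → ℝ} (hg : ∀ x, 0 ≤ g x) (k : Fin N)
    (v : Fin (N + 1) → Strategy X) :
    ∑ c, strategyLaw tx pX k.castSucc c * ratio pX (fun x => pX x * g x) (tail tx (k + 1))
      (tail tx k) (stage tx x₀ (Function.update v k.castSucc c) N) ≤ 1 := by
  set x := stage tx x₀ v (N - 1 - k)
  set w : (∀ j, X j) → ℝ := fun x => pX x * g x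
  have hsub : tail tx (k + 1) ⊆ tail tx k := tail_mono (Nat.le_succ _)
  have h1 : ∀ c : Strategy X, ratio pX w (tail tx (k + 1)) (tail tx k)
      (stage tx x₀ (Function.update v k.castSucc c) N) =
      ratio pX w (tail tx (k + 1)) (tail tx k) (Function.update x (tx k) (c x (tx k))) := by
    intro c
    apply ratio_congr _ _ hsub
    rw [sub_tail_stage htx, stage_update]
  simp only [h1]
  have h2 := sum_strategyLaw_mul (tx := tx) hpX.2 k.castSucc x (fun x' =>
    ratio pX w (tail tx (k + 1)) (tail tx k) (Function.update x (tx k) (x' (tx k))))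
  refine h2.trans_le ?_
  have h3 : ∀ x' : ∀ j, X j, sub (tail tx (k + 1)) (Function.update x (tx k) (x' (tx k))) =
      sub (tail tx (k + 1)) x := by
    intro x'
    rw [sub_eq_iff]
    intro j hj
    rw [Function.update_of_ne]
    rintro rfl
    exact notMem_tail_succ htx k hj
  -- For a null prefix, where the kernel is only a fallback, the numerator of the ratio vanishes.
  by_cases h0 : law pX (sub (tail tx (k + 1))) (sub (tail tx (k + 1)) x) = 0
  · have h4 : ∀ x' : ∀ j, X j, ratio pX w (tail tx (k + 1)) (tail tx k)
        (Function.update x (tx k) (x' (tx k))) = 0 := by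
      intro x'
      unfold ratio
      rw [h3, h0]
      simp
    simp [h4]
  · refine le_trans (le_of_eq ?_) (sum_condKer_mul_ratio_le hpX.1 hg hsub x h0)
    refine Finset.sum_congr rfl fun x' _ => ?_
    change condKer pX (tail tx (k + 1)) x x' * _ = _
    by_cases e : sub (tail tx (k + 1)) x' = sub (tail tx (k + 1)) x
    · congr 1
      apply ratio_congr _ _ hsub
      rw [sub_eq_iff]
      intro j hj
      by_cases hjk : j = tx k
      · subst hjk; simp
      · rw [Function.update_of_ne hjk]
        exact (sub_eq_iff.1 e j ((mem_tail_iff.1 hj).resolve_left hjk)).symm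
    · have : condKer pX (tail tx (k + 1)) x x' = 0 := by
        unfold condKer
        rw [if_neg h0, if_neg e]
      rw [this, zero_mul, zero_mul]

/-- For nonzero entropy the drift is `-r * H + I`, by `sum_log_sideCond` and `rateInfo_eq`.
Independence lets expectations over letters be computed under `pX`. -/
theorem dfScheme_valid [DecidableEq (∀ j, X j)] (hpS : pS ∈ stdSimplex ℝ (∀ i, S i))
    (hW : ∀ x, W x ∈ stdSimplex ℝ (∀ v, Y v)) (hpX : pX ∈ stdSimplex ℝ (∀ j, X j))
    (hπ : Function.Injective π) (hπ0 : π 0 = 0) (hπN : π (Fin.last N) = Fin.last (K + 1))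
    (htx : ∀ l : Fin N, π l.castSucc = (tx l).castSucc) (hind : IndepOfRest pX (cooperating π))
    {r : ℝ} (hr : 0 < r)
    (hrate : ∀ (i : Fin (N + 1)) (u : Fin (K + 1)), π i = u.succ →
      sourceEntropy pS u.succ ≠ 0 → r * sourceEntropy pS u.succ < rateInfo pX W π i u) :
    (dfScheme pS W pX x₀ hπ hπ0 hπN htx).Valid pS W r := by
  classical
  have hinj := tx_injective hπ htx
  rw [cooperating_eq hπN htx] at hind
  have hlaw := fun F => sum_strategies (x₀ := x₀) hpX.1 hpX.2 hind F
  -- Testing the law identity on a point mass shows that letters of positive probability produce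
  -- inputs in the support of `pX`.
  have hpos : ∀ v : Fin (N + 1) → Strategy X, 0 < ∏ l, strategyLaw tx pX l (v l) →
      0 < pX (stage tx x₀ v N) := by
    intro v hv
    have h1 := hlaw (fun x => if x = stage tx x₀ v N then 1 else 0)
    simp only [mul_ite, mul_one, mul_zero, Finset.sum_ite_eq', Finset.mem_univ, if_true] at h1
    rw [← h1]
    refine lt_of_lt_of_le hv ?_
    have h2 := Finset.single_le_sum (f := fun v' : Fin (N + 1) → Strategy X =>
      if stage tx x₀ v' N = stage tx x₀ v N then ∏ l, strategyLaw tx pX l (v' l) else 0)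
      (fun v' _ => by
        split_ifs
        · exact Finset.prod_nonneg fun l _ => strategyLaw_nonneg hpX.1 l _
        · exact le_rfl) (Finset.mem_univ v)
    simpa using h2
  have hactive : ∀ u, (dfScheme pS W pX x₀ hπ hπ0 hπN htx).Active u →
      ∃ i : Fin (N + 1), π i = u.succ := by
    rintro u (rfl | h)
    · exact ⟨Fin.last N, hπN⟩
    · exact exists_of_termLevel_lt h
  refine ⟨fun l v => strategyLaw_nonneg hpX.1 l v, fun l => sum_strategyLaw hpX.2 l, ?_, ?_, ?_,
    ?_, ?_, ?_, ?_⟩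
  · intro u c σ
    have := sideCond_nonneg hpS.1 u c σ
    simp only [dfScheme]
    split_ifs <;> linarith
  · intro u _ s hs
    have := sideCond_pos hpS.1 u hs
    simp only [dfScheme]
    split_ifs <;> linarith
  · intro u _ m s hs
    simp only [dfScheme]
    by_cases hu : sourceEntropy pS u.succ = 0
    · refine le_trans (le_of_eq (Finset.sum_eq_zero fun c _ => ?_)) zero_le_one
      split_ifs with hc
      · rfl
      · obtain ⟨l, hl⟩ := Function.ne_iff.1 hc
        refine Finset.prod_eq_zero (Finset.mem_univ l) ?_
        rw [sideCond_eq_zero hpS.1 hu (hs l) hl, mul_zero]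
    · simp only [if_neg hu]
      refine le_trans (Finset.sum_le_sum fun c _ => ?_) (sum_side_prod_le hpS.1 u m s)
      split_ifs
      · exact Finset.prod_nonneg fun l _ => sideCond_nonneg hpS.1 _ _ _
      · exact le_rfl
  · intro u k v y
    simp only [dfScheme]
    split_ifs
    · exact zero_le_one
    · exact ratio_nonneg hpX.1 (fun x => mul_nonneg (hpX.1 x) (outProb_nonneg hW u y x)) _ _ _
  · rintro u _ k _ ⟨v, y⟩ hvy
    simp only [dfScheme]
    split_ifs
    · exact zero_lt_one
    · change 0 < (∏ l, strategyLaw tx pX l (v l)) * W (stage tx x₀ v N) y at hvy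
      have h1 : 0 ≤ ∏ l, strategyLaw tx pX l (v l) :=
        Finset.prod_nonneg fun l _ => strategyLaw_nonneg hpX.1 l _
      have h2 : 0 < ∏ l, strategyLaw tx pX l (v l) := pos_of_mul_pos_left hvy ((hW _).1 _)
      have h3 : 0 < W (stage tx x₀ v N) y := pos_of_mul_pos_right hvy h1
      exact ratio_pos hpX.1 (fun x => mul_nonneg (hpX.1 x) (outProb_nonneg hW u _ x)) (hpos v h2)
        (mul_pos (hpos v h2) (outProb_pos hW u h3)) _ _
  · intro u _ k hk v y
    simp only [dfScheme]
    by_cases hu : sourceEntropy pS u.succ = 0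
    · simp only [if_pos hu, mul_one]
      exact (sum_strategyLaw hpX.2 k).le
    · simp only [if_neg hu]
      have hkN : k.1 < N := lt_of_lt_of_le hk (termLevel_le π _)
      exact sum_strategyLaw_mul_ratio_le hpX hinj (fun x => outProb_nonneg hW u y x) ⟨k.1, hkN⟩ v
  · intro u hu
    obtain ⟨i, hi⟩ := hactive u hu
    by_cases hs : sourceEntropy pS u.succ = 0
    · simp only [dfScheme, if_pos hs, Real.log_one, mul_zero, Finset.sum_const_zero, add_zero]
      have h1 : ∀ s, pS s * Real.log (2 * sideCond pS u (s 0) (s u.succ)) = pS s * Real.log 2 := by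
        intro s
        rcases (hpS.1 s).eq_or_lt with h | h
        · simp [← h]
        · rw [sideCond_eq_one hpS.1 hs h, mul_one]
      simp only [h1, ← Finset.sum_mul, hpS.2, one_mul]
      exact mul_pos hr (Real.log_pos one_lt_two)
    · have h1 := hrate i u hi hs
      have h2 : (dfScheme pS W pX x₀ hπ hπ0 hπN htx).level u.succ = i.1 := by
        change termLevel π u.succ = i.1
        rw [← hi, termLevel_apply hπ]
      rw [h2]
      simp only [dfScheme, if_neg hs]
      rw [sum_log_sideCond]
      rw [rateInfo_eq hW hpX.1 hπN htx] at h1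
      have h3 : ∀ k, ∑ p, (dfScheme pS W pX x₀ hπ hπ0 hπN htx).letterOutputLaw W p *
          Real.log (ratio pX (fun x => pX x * outProb W u (p.2 u) x) (tail tx (k + 1)) (tail tx k)
            (stage tx x₀ p.1 N)) = ∑ x, pX x * ∑ z, W x z *
          Real.log (ratio pX (fun x => pX x * outProb W u (z u) x) (tail tx (k + 1)) (tail tx k)
            x) := by
        intro k
        rw [← hlaw (fun x => ∑ z, W x z * Real.log (ratio pX (fun x => pX x * outProb W u (z u) x)
          (tail tx (k + 1)) (tail tx k) x)), Fintype.sum_prod_type]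
        refine Finset.sum_congr rfl fun v _ => ?_
        rw [Finset.mul_sum]
        refine Finset.sum_congr rfl fun z _ => ?_
        exact mul_assoc _ _ _
      have h4 := Finset.sum_congr (rfl : Finset.range i.1 = Finset.range i.1) fun k _ => h3 k
      unfold dfScheme at h4
      rw [h4]
      linarith

/-- Finitely many strict rate conditions leave room for a larger rate. -/
theorem exists_rate_gt {ι : Type*} [Finite ι] (h I : ι → ℝ) {r : ℝ}
    (hr : ∀ i, r * h i < I i) : ∃ r', r < r' ∧ ∀ i, r' * h i < I i := by
  have h1 : ∀ᶠ r' in nhdsWithin r (Set.Ioi r), ∀ i, r' * h i < I i := by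
    rw [Filter.eventually_all]
    intro i
    have hc : Filter.Tendsto (fun r' : ℝ => r' * h i) (nhds r) (nhds (r * h i)) :=
      (continuous_mul_const (h i)).tendsto r
    exact (hc.eventually (gt_mem_nhds (hr i))).filter_mono nhdsWithin_le_nhds
  obtain ⟨r', h2, h3⟩ := (h1.and self_mem_nhdsWithin).exists
  exact ⟨r', h3, h2⟩

theorem nonempty_of_mem_stdSimplex {Ω : Type*} [Fintype Ω] {p : Ω → ℝ} (hp : p ∈ stdSimplex ℝ Ω) :
    Nonempty Ω := by
  by_contra hc
  rw [not_nonempty_iff] at hc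
  simpa using hp.2

end DecodeForward

end RelayNetwork

open RelayNetwork

/-- In `hr`, the index `v` with `π i = v.succ` is the channel output of terminal `π i`; it exists
exactly for `i = 1, …, N`.  A quotient with denominator `H(S_0 | S_{π i}) = 0` counts as `+∞`. -/
theorem theorem1 {K : ℕ} {S : Fin (K + 2) → Type*} {X Y : Fin (K + 1) → Type*}
    [∀ i, Fintype (S i)] [∀ j, Fintype (X j)] [∀ v, Fintype (Y v)]
    (pS : (∀ i, S i) → ℝ) (hpS : pS ∈ stdSimplex ℝ (∀ i, S i))
    (W : (∀ j, X j) → (∀ v, Y v) → ℝ) (hW : ∀ x, W x ∈ stdSimplex ℝ (∀ v, Y v))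
    (r : ℝ) (hr0 : 0 ≤ r)
    (N : ℕ) (hN1 : 1 ≤ N) (hNK : N ≤ K + 1)
    (π : Fin (N + 1) → Fin (K + 2)) (hπ : Function.Injective π)
    (hπ0 : π 0 = 0) (hπN : π (Fin.last N) = Fin.last (K + 1))
    (pX : (∀ j, X j) → ℝ) (hpX : pX ∈ stdSimplex ℝ (∀ j, X j))
    (hind : RelayNetwork.IndepOfRest pX (RelayNetwork.cooperating π))
    (hr : ∀ (i : Fin (N + 1)) (v : Fin (K + 1)), π i = v.succ →
      RelayNetwork.sourceEntropy pS (π i) ≠ 0 →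
      r < RelayNetwork.rateInfo pX W π i v / RelayNetwork.sourceEntropy pS (π i)) :
    RelayNetwork.Achievable pS W r := by
  classical
  obtain ⟨x₀⟩ := nonempty_of_mem_stdSimplex hpX
  obtain ⟨d⟩ := nonempty_of_mem_stdSimplex hpS
  obtain ⟨y₀⟩ := nonempty_of_mem_stdSimplex (hW x₀)
  have hex : ∀ l : Fin N, ∃ j : Fin (K + 1), π l.castSucc = j.castSucc := by
    intro l
    have hne : π l.castSucc ≠ Fin.last (K + 1) := by
      rw [← hπN]
      exact fun h => (Fin.castSucc_lt_last l).ne (hπ h)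
    obtain ⟨j, hj⟩ := Fin.exists_castSucc_eq.2 hne
    exact ⟨j, hj.symm⟩
  choose tx htx using hex
  -- The larger rate pays for the `N` additional channel blocks and is positive even if `r = 0`, as
  -- the drift at entropy zero requires.
  obtain ⟨r', hrr', hr'⟩ := exists_rate_gt
    (ι := {p : Fin (N + 1) × Fin (K + 1) // π p.1 = p.2.succ ∧ sourceEntropy pS p.2.succ ≠ 0})
    (fun p => sourceEntropy pS p.1.2.succ) (fun p => rateInfo pX W π p.1.1 p.1.2) (r := r) (by
      rintro ⟨⟨i, u⟩, hi, hH⟩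
      have h1 : 0 < sourceEntropy pS u.succ :=
        lt_of_le_of_ne (condEntropy_nonneg hpS.1 _ _) (Ne.symm hH)
      have h2 := hr i u hi (by rw [hi]; exact hH)
      rw [hi, lt_div_iff₀ h1] at h2
      exact h2)
  have hvalid := dfScheme_valid (x₀ := x₀) hpS hW hpX hπ hπ0 hπN htx hind
    (lt_of_le_of_lt hr0 hrr') fun i u hi hH => hr' ⟨(i, u), hi, hH⟩
  exact hvalid.achievable (lt_of_le_of_lt hr0 hrr') hrr' hpS hW d y₀
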